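/- Work on the real RAM: memory cells hold natural numbers or real numbers, indirect addressing is allowed, and addition and (truncated) subtraction of natural numbers, the four arithmetic operations on real numbers, comparisons and memory accesses each take one unit of time (there is no rounding of real numbers). A unit disk is a closed disk of radius $1$ in the Euclidean plane. In the $k$-colorable discrete unit disk cover problem ($k$-CDUDC) one is given a set $P$ of $n\ge 1$ points and a set $D$ of $m$ unit disks in the plane and an integer $k\ge 1$, such that $D$ contains a $k$-colorable cover of $P$. Here a $k$-colorable cover of $P$ is a subset $D'\subseteq D$ such that every point of $P$ lies in a disk of $D'$ and there is a map $\chi:D'\to\{1,\dots,k\}$ with $\chi(d)\neq\chi(d')$ for all distinct $d,d'\in D'$ with $d\cap d'\neq\emptyset$. A $4$-approximation algorithm computes, from $P$, $D$ and $k$, a set $D'\subseteq D$ that covers $P$ together with a map $\chi:D'\to\{1,\dots,4k\}$ such that $\chi(d)\ne\chi(d')$ for all distinct $d,d'\in D'$ with $d\cap d'\neq\emptyset$. Theorem. There is a $4$-approximation algorithm for $k$-CDUDC (a single algorithm, with $k$ as part of the input) that runs in $O(m^{6k}\,n\,\log (k+1))$ time, with an absolute implied constant. Corollary. There is a $4$-approximation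 algorithm for $3$-CDUDC that runs in $O(m^{18}n)$ time. -/

import Mathlib

/-! ### The geometric problem -/

/-- The Euclidean plane. -/
abbrev Plane : Type := EuclideanSpace ℝ (Fin 2)

/-- The (closed) disk of radius `1` with centre `c`. -/
def unitDisk (c : Plane) : Set Plane := Metric.closedBall c 1

/-- `P` lists `n` points, `D` lists the centres of `m` unit disks. The disks with index in `S`
cover all the points of `P`, and `χ` colours them with colours from `{1, …, k}` in such a way that
intersecting disks receive distinct colours. -/
def IsColoredCover {n m : ℕ} (P : Fin n → Plane) (D : Fin m → Plane) (k : ℕ)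
    (S : Finset (Fin m)) (χ : Fin m → ℕ) : Prop :=
  (∀ p : Fin n, ∃ d ∈ S, P p ∈ unitDisk (D d)) ∧
  (∀ d ∈ S, χ d ∈ Finset.Icc 1 k) ∧
  (∀ d ∈ S, ∀ d' ∈ S, d ≠ d' →
    (unitDisk (D d) ∩ unitDisk (D d')).Nonempty → χ d ≠ χ d')

/-- The disks contain a `k`-colourable cover of the points. -/
def HasColorableCover {n m : ℕ} (P : Fin n → Plane) (D : Fin m → Plane) (k : ℕ) : Prop :=
  ∃ (S : Finset (Fin m)) (χ : Fin m → ℕ), IsColoredCover P D k S χ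

/-! ### A real RAM

The memory consists of arrays of natural numbers and arrays of real numbers; array names and
indices are natural numbers, and an index may be computed (indirect addressing). A scalar variable
is a cell with a constant index. Unit-cost operations are: addition and truncated subtraction of
natural numbers, the four arithmetic operations on real numbers, comparisons, memory accesses.
There is no multiplication of natural numbers, no rounding and no conversion of real numbers into
natural numbers, and the constants of a program are natural and rational numbers. -/

namespace RealRAM

/-- A memory state: `s.int a i` and `s.real a i` are the `i`-th cells of the arrays named `a`. -/
structure Store where
  int : ℕ → ℕ → ℕ
  real : ℕ → ℕ → ℝ

/-- Expressions with values in the natural numbers. -/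
inductive IntExp where
  | const (c : ℕ)
  | get (a : ℕ) (i : IntExp)
  | add (e f : IntExp)
  | sub (e f : IntExp)

/-- Expressions with real values. -/
inductive RealExp where
  | const (q : ℚ)
  | get (a : ℕ) (i : IntExp)
  | add (e f : RealExp)
  | sub (e f : RealExp)
  | mul (e f : RealExp)
  | div (e f : RealExp)

/-- Tests. -/
inductive Test where
  | intLe (e f : IntExp)
  | realLe (e f : RealExp)
  | not (b : Test)
  | and (b c : Test)

/-- Programs. -/
inductive Program where
  | skip
  | setInt (a : ℕ) (i e : IntExp)
  | setReal (a : ℕ) (i : IntExp) (e : RealExp)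
  | seq (p q : Program)
  | ifElse (b : Test) (p q : Program)
  | loop (b : Test) (p : Program)

namespace IntExp

def eval (s : Store) : IntExp → ℕ
  | const c => c
  | get a i => s.int a (i.eval s)
  | add e f => e.eval s + f.eval s
  | sub e f => e.eval s - f.eval s

/-- The number of operations performed when the expression is evaluated. -/
def cost : IntExp → ℕ
  | const _ => 1
  | get _ i => i.cost + 1
  | add e f => e.cost + f.cost + 1
  | sub e f => e.cost + f.cost + 1

end IntExp

namespace RealExp

/-- The value of an expression; a division by zero returns `0`. -/
noncomputable def eval (s : Store) : RealExp → ℝ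
  | const q => (q : ℝ)
  | get a i => s.real a (i.eval s)
  | add e f => e.eval s + f.eval s
  | sub e f => e.eval s - f.eval s
  | mul e f => e.eval s * f.eval s
  | div e f => e.eval s / f.eval s

/-- The number of operations performed when the expression is evaluated. -/
def cost : RealExp → ℕ
  | const _ => 1
  | get _ i => i.cost + 1
  | add e f => e.cost + f.cost + 1
  | sub e f => e.cost + f.cost + 1
  | mul e f => e.cost + f.cost + 1
  | div e f => e.cost + f.cost + 1

end RealExp

namespace Test

def Holds (s : Store) : Test → Prop
  | intLe e f => e.eval s ≤ f.eval s
  | realLe e f => e.eval s ≤ f.eval s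
  | not b => ¬ b.Holds s
  | and b c => b.Holds s ∧ c.Holds s

/-- The number of operations performed when the test is evaluated. -/
def cost : Test → ℕ
  | intLe e f => e.cost + f.cost + 1
  | realLe e f => e.cost + f.cost + 1
  | not b => b.cost + 1
  | and b c => b.cost + c.cost + 1

end Test

namespace Store

def setInt (s : Store) (a i v : ℕ) : Store :=
  { s with int := Function.update s.int a (Function.update (s.int a) i v) }

noncomputable def setReal (s : Store) (a i : ℕ) (v : ℝ) : Store :=
  { s with real := Function.update s.real a (Function.update (s.real a) i v) }

end Store

/-- `Exec p s t s'`: started in the memory state `s`, the program `p` halts after exactly `t`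
operations in the memory state `s'`. -/
inductive Exec : Program → Store → ℕ → Store → Prop where
  | skip (s : Store) : Exec .skip s 1 s
  | setInt (a : ℕ) (i e : IntExp) (s : Store) :
      Exec (.setInt a i e) s (i.cost + e.cost + 1) (s.setInt a (i.eval s) (e.eval s))
  | setReal (a : ℕ) (i : IntExp) (e : RealExp) (s : Store) :
      Exec (.setReal a i e) s (i.cost + e.cost + 1) (s.setReal a (i.eval s) (e.eval s))
  | seq {p q : Program} {s s' s'' : Store} {t t' : ℕ} :
      Exec p s t s' → Exec q s' t' s'' → Exec (.seq p q) s (t + t') s''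
  | ifTrue {b : Test} {p q : Program} {s s' : Store} {t : ℕ} :
      b.Holds s → Exec p s t s' → Exec (.ifElse b p q) s (b.cost + t) s'
  | ifFalse {b : Test} {p q : Program} {s s' : Store} {t : ℕ} :
      ¬ b.Holds s → Exec q s t s' → Exec (.ifElse b p q) s (b.cost + t) s'
  | loopStop {b : Test} {p : Program} {s : Store} :
      ¬ b.Holds s → Exec (.loop b p) s b.cost s
  | loopStep {b : Test} {p : Program} {s s' s'' : Store} {t t' : ℕ} :
      b.Holds s → Exec p s t s' → Exec (.loop b p) s' t' s'' →
      Exec (.loop b p) s (b.cost + t + t') s''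

end RealRAM


/-- The memory state that holds the instance `(P, D, k)`: the first three cells of the array `0` of
natural numbers are `n`, `m`, `k`; the real arrays `0`, `1` hold the coordinates of the points, the
real arrays `2`, `3` hold the coordinates of the centres; all the other cells are `0`. -/
noncomputable def inputStore {n m : ℕ} (P : Fin n → Plane) (D : Fin m → Plane) (k : ℕ) :
    RealRAM.Store where
  int a i :=
    if a = 0 ∧ i = 0 then n else if a = 0 ∧ i = 1 then m else if a = 0 ∧ i = 2 then k else 0
  real a i :=
    if h : i < n ∧ a = 0 then P ⟨i, h.1⟩ 0
    else if h : i < n ∧ a = 1 then P ⟨i, h.1⟩ 1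
    else if h : i < m ∧ a = 2 then D ⟨i, h.1⟩ 0
    else if h : i < m ∧ a = 3 then D ⟨i, h.1⟩ 1
    else 0

/-- The output is read off from the array `1` of natural numbers: its `d`-th cell is the colour of
the `d`-th disk, and `0` if that disk is not selected. -/
def outputColor (s : RealRAM.Store) {m : ℕ} (d : Fin m) : ℕ := s.int 1 d

/-- The set of the disks that the output selects. -/
def outputDisks (s : RealRAM.Store) (m : ℕ) : Finset (Fin m) :=
  Finset.univ.filter fun d => outputColor s d ≠ 0

/-- `A` is a `ρ`-approximation algorithm, with running time at most `T n m`, for the problem with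
`k` colours: for all `n ≥ 1` points and `m` unit disks that contain a `k`-colourable cover of the
points, `A` halts after at most `T n m` operations and its output is a cover of the points by some
of the disks together with a proper colouring that uses at most `ρ * k` colours. -/
def ApproximatesWithin (A : RealRAM.Program) (ρ k : ℕ) (T : ℕ → ℕ → ℝ) : Prop :=
  ∀ (n m : ℕ) (P : Fin n → Plane) (D : Fin m → Plane),
    0 < n → HasColorableCover P D k →
    ∃ (t : ℕ) (s : RealRAM.Store),
      RealRAM.Exec A (inputStore P D k) t s ∧ (t : ℝ) ≤ T n m ∧
      IsColoredCover P D (ρ * k) (outputDisks s m) (fun d => outputColor s d)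


/-!
The points are covered by strips of height `7 / 5`, chosen greedily: each strip begins at the lowest
point above the previous strips. A strip concerns only the disks whose centres are at distance at
most `1` from it. The bases of strips whose numbers differ by `4` are at least `28 / 5` apart,
hence the centres of their disks are at least `11 / 5 > 2` apart vertically, so that four palettes
of `k` colours suffice for all the strips.

In a strip, sets of pairs (disk, colour) without conflicts are built up from the left to the right.
Whether a set can be completed depends only on its window, the pairs whose centres are at most `2`
to the left of the last one, so that of all sets with the same window a single one is explored.
The window splits into four cells of size `1 × 17 / 10`; as `1 ^ 2 + 1.7 ^ 2 < 4`, a cell contains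
at most one disk of each colour, so that there are at most `(m + 1) ^ (4 * k)` windows. One may
assume `k ≤ m`, which turns this bound into `O(m ^ (4 * k))`.
-/

namespace RealRAM

namespace Store

variable (s : Store) {a b : ℕ} (i v : ℕ) (x : ℝ)

theorem setInt_int_self : (s.setInt a i v).int a = Function.update (s.int a) i v := by
  simp [setInt]

theorem setInt_int_of_ne (h : b ≠ a) : (s.setInt a i v).int b = s.int b := by
  simp [setInt, h]

theorem setInt_real : (s.setInt a i v).real = s.real := rfl

theorem setReal_int : (s.setReal a i x).int = s.int := rfl

theorem setReal_real_self : (s.setReal a i x).real a = Function.update (s.real a) i x := by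
  simp [setReal]

theorem setReal_real_of_ne (h : b ≠ a) : (s.setReal a i x).real b = s.real b := by
  simp [setReal, h]

end Store

namespace Program

/-- Whether the program contains an assignment to the array `b` of natural numbers. -/
def writesInt : Program → ℕ → Bool
  | skip, _ => false
  | setInt a _ _, b => a == b
  | setReal _ _ _, _ => false
  | seq p q, b => p.writesInt b || q.writesInt b
  | ifElse _ p q, b => p.writesInt b || q.writesInt b
  | loop _ p, b => p.writesInt b

/-- Whether the program contains an assignment to the array `b` of real numbers. -/
def writesReal : Program → ℕ → Bool
  | skip, _ => false
  | setInt _ _ _, _ => false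
  | setReal a _ _, b => a == b
  | seq p q, b => p.writesReal b || q.writesReal b
  | ifElse _ p q, b => p.writesReal b || q.writesReal b
  | loop _ p, b => p.writesReal b

/-- Whether the program contains no loop. -/
def loopFree : Program → Bool
  | skip => true
  | setInt _ _ _ => true
  | setReal _ _ _ => true
  | seq p q => p.loopFree && q.loopFree
  | ifElse _ p q => p.loopFree && q.loopFree
  | loop _ _ => false

open scoped Classical in
/-- The final memory state of a program without loops; a loop is treated as `skip`. -/
noncomputable def run : Program → Store → Store
  | skip, s => s
  | setInt a i e, s => s.setInt a (i.eval s) (e.eval s)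
  | setReal a i e, s => s.setReal a (i.eval s) (e.eval s)
  | seq p q, s => q.run (p.run s)
  | ifElse b p q, s => if b.Holds s then p.run s else q.run s
  | loop _ _, s => s

/-- An upper bound for the running time of a program without loops; a loop counts as `0`. -/
def maxCost : Program → ℕ
  | skip => 1
  | setInt _ i e => i.cost + e.cost + 1
  | setReal _ i e => i.cost + e.cost + 1
  | seq p q => p.maxCost + q.maxCost
  | ifElse b p q => b.cost + max p.maxCost q.maxCost
  | loop _ _ => 0

end Program

/-- The frame condition of a program: the states `s` and `s'` agree on all the arrays to which `p`
does not assign. -/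
structure AgreeOff (p : Program) (s s' : Store) : Prop where
  int : ∀ a, p.writesInt a = false → s'.int a = s.int a
  real : ∀ a, p.writesReal a = false → s'.real a = s.real a

namespace AgreeOff

variable {p q : Program} {s s' s'' : Store}

theorem refl (p : Program) (s : Store) : AgreeOff p s s := ⟨fun _ _ => rfl, fun _ _ => rfl⟩

theorem trans (h : AgreeOff p s s') (h' : AgreeOff p s' s'') : AgreeOff p s s'' :=
  ⟨fun a ha => (h'.int a ha).trans (h.int a ha), fun a ha => (h'.real a ha).trans (h.real a ha)⟩

theorem of_writes_le (h : AgreeOff p s s') (hi : ∀ a, p.writesInt a ≤ q.writesInt a)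
    (hr : ∀ a, p.writesReal a ≤ q.writesReal a) : AgreeOff q s s' :=
  ⟨fun a ha => h.int a (Bool.eq_false_of_le_false (ha ▸ hi a)),
    fun a ha => h.real a (Bool.eq_false_of_le_false (ha ▸ hr a))⟩

theorem seq_left (h : AgreeOff p s s') : AgreeOff (.seq p q) s s' :=
  h.of_writes_le (fun _ => Bool.left_le_or _ _) fun _ => Bool.left_le_or _ _

theorem seq_right (h : AgreeOff q s s') : AgreeOff (.seq p q) s s' :=
  h.of_writes_le (fun _ => Bool.right_le_or _ _) fun _ => Bool.right_le_or _ _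

theorem seq (h : AgreeOff p s s') (h' : AgreeOff q s' s'') : AgreeOff (.seq p q) s s'' :=
  h.seq_left.trans h'.seq_right

theorem loop {b : Test} (h : AgreeOff p s s') : AgreeOff (.loop b p) s s' := ⟨h.int, h.real⟩

end AgreeOff

theorem Exec.agreeOff {p : Program} {s s' : Store} {t : ℕ} (h : Exec p s t s') :
    AgreeOff p s s' := by
  induction h with
  | skip s => exact .refl _ _
  | setInt a i e s =>
    refine ⟨fun b hb => s.setInt_int_of_ne _ _ ?_, fun b _ => rfl⟩
    rintro rfl
    simp [Program.writesInt] at hb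
  | setReal a i e s =>
    refine ⟨fun b _ => rfl, fun b hb => s.setReal_real_of_ne _ _ ?_⟩
    rintro rfl
    simp [Program.writesReal] at hb
  | seq _ _ ih ih' => exact ih.seq ih'
  | ifTrue _ _ ih =>
    exact ih.of_writes_le (fun _ => Bool.left_le_or _ _) fun _ => Bool.left_le_or _ _
  | ifFalse _ _ ih =>
    exact ih.of_writes_le (fun _ => Bool.right_le_or _ _) fun _ => Bool.right_le_or _ _
  | loopStop _ => exact .refl _ _
  | loopStep _ _ _ ih ih' => exact ih.loop.trans ih'

/-- Total correctness with a time bound: started in `s`, the program `p` halts after at most `T`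
operations in a state that satisfies `Q`. -/
def Runs (p : Program) (s : Store) (T : ℕ) (Q : Store → Prop) : Prop :=
  ∃ t s', Exec p s t s' ∧ t ≤ T ∧ Q s'

namespace Runs

variable {p q : Program} {s : Store} {T T' : ℕ} {Q Q' : Store → Prop}

theorem mono (h : Runs p s T Q) (hT : T ≤ T') (hQ : ∀ s', AgreeOff p s s' → Q s' → Q' s') :
    Runs p s T' Q' := by
  obtain ⟨t, s', he, ht, hq⟩ := h
  exact ⟨t, s', he, ht.trans hT, hQ s' he.agreeOff hq⟩

theorem seq (h : Runs p s T Q') (hq : ∀ s', AgreeOff p s s' → Q' s' → Runs q s' T' Q) :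
    Runs (.seq p q) s (T + T') Q := by
  obtain ⟨t, s', he, ht, hQ'⟩ := h
  obtain ⟨t', s'', he', ht', hQ⟩ := hq s' he.agreeOff hQ'
  exact ⟨t + t', s'', he.seq he', by lia, hQ⟩

theorem ifElse {b : Test} (hp : b.Holds s → Runs p s T Q) (hq : ¬ b.Holds s → Runs q s T Q) :
    Runs (.ifElse b p q) s (b.cost + T) Q := by
  by_cases hb : b.Holds s
  · obtain ⟨t, s', he, ht, hQ⟩ := hp hb
    exact ⟨b.cost + t, s', .ifTrue hb he, by lia, hQ⟩
  · obtain ⟨t, s', he, ht, hQ⟩ := hq hb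
    exact ⟨b.cost + t, s', .ifFalse hb he, by lia, hQ⟩

theorem of_loopFree (h : p.loopFree = true) (hT : p.maxCost ≤ T) (hQ : Q (p.run s)) :
    Runs p s T Q := by
  suffices H : Runs p s p.maxCost fun s' => s' = p.run s from
    H.mono hT fun _ _ hs' => hs' ▸ hQ
  clear hT hQ
  induction p generalizing s with
  | skip => exact ⟨_, _, .skip s, le_rfl, rfl⟩
  | setInt a i e => exact ⟨_, _, .setInt a i e s, le_rfl, rfl⟩
  | setReal a i e => exact ⟨_, _, .setReal a i e s, le_rfl, rfl⟩
  | seq p q ihp ihq =>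
    rw [Program.loopFree, Bool.and_eq_true] at h
    refine (ihp h.1).seq fun s' _ hs' => ?_
    exact hs' ▸ ihq h.2
  | ifElse b p q ihp ihq =>
    rw [Program.loopFree, Bool.and_eq_true] at h
    refine ifElse (fun hb => ?_) fun hb => ?_
    · exact (ihp h.1).mono (le_max_left _ _) fun _ _ hs' => by rw [hs', Program.run, if_pos hb]
    · exact (ihq h.2).mono (le_max_right _ _) fun _ _ hs' => by rw [hs', Program.run, if_neg hb]
  | loop b p => simp [Program.loopFree] at h

theorem loop {b : Test} {s₀ : Store} (I : ℕ → Store → Prop) (N T : ℕ) (h₀ : I 0 s₀)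
    (hstep : ∀ j s, AgreeOff p s₀ s → I j s → b.Holds s → j < N ∧ Runs p s T (I (j + 1))) :
    Runs (.loop b p) s₀ (N * (b.cost + T) + b.cost) fun s' => ∃ j, I j s' ∧ ¬ b.Holds s' := by
  suffices H : ∀ r j s, AgreeOff p s₀ s → I j s → N - j = r →
      Runs (.loop b p) s (r * (b.cost + T) + b.cost) fun s' => ∃ j, I j s' ∧ ¬ b.Holds s' from
    H N 0 s₀ (.refl _ _) h₀ rfl
  intro r
  induction r with
  | zero =>
    intro j s hs hI hr
    by_cases hb : b.Holds s
    · have := (hstep j s hs hI hb).1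
      lia
    · exact ⟨_, _, .loopStop hb, by lia, j, hI, hb⟩
  | succ r ih =>
    intro j s hs hI hr
    by_cases hb : b.Holds s
    · obtain ⟨t, s', he, ht, hI'⟩ := (hstep j s hs hI hb).2
      obtain ⟨t', s'', he', ht', hq⟩ := ih (j + 1) s' (hs.trans he.agreeOff) hI' (by lia)
      refine ⟨_, _, .loopStep hb he he', ?_, hq⟩
      rw [Nat.succ_mul]
      lia
    · exact ⟨_, _, .loopStop hb, by lia, j, hI, hb⟩

end Runs

theorem AgreeOff.run {p : Program} {s : Store} (h : p.loopFree = true) :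
    AgreeOff p s (p.run s) := by
  obtain ⟨t, s', he, -, hs'⟩ := Runs.of_loopFree h le_rfl (Q := (· = p.run s)) rfl
  exact hs' ▸ he.agreeOff

/-- The value of the scalar variable `a`, which is the cell `0` of the array `a`. -/
abbrev IntExp.var (a : ℕ) : IntExp := .get a (.const 0)

/-- The assignment of a value to a scalar variable. -/
abbrev Program.setVar (a : ℕ) (e : IntExp) : Program := .setInt a (.const 0) e

/-- For `v = 0, 1, …`, as long as `v` is less than the value of `b`, execute `p`. -/
abbrev Program.forLoop (v : ℕ) (b : IntExp) (p : Program) : Program :=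
  .seq (.setVar v (.const 0))
    (.loop (.not (.intLe b (.var v))) (.seq p (.setVar v (.add (.var v) (.const 1)))))

theorem Runs.forLoop {p : Program} {v : ℕ} {b : IntExp} {s₀ : Store} (N T : ℕ)
    (I : ℕ → Store → Prop)
    (hb : ∀ s, AgreeOff (.forLoop v b p) s₀ s → b.eval s = N)
    (hv : p.writesInt v = false)
    (h₀ : I 0 (s₀.setInt v 0 0))
    (hstep : ∀ i s, i < N → AgreeOff (.forLoop v b p) s₀ s → s.int v 0 = i → I i s →
      Runs p s T fun s' => I (i + 1) (s'.setInt v 0 (i + 1))) :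
    Runs (.forLoop v b p) s₀ (N * (T + b.cost + 10) + b.cost + 10) (I N) := by
  have hset : Runs (.setVar v (.const 0)) s₀ 3 fun s => s = s₀.setInt v 0 0 :=
    .of_loopFree rfl le_rfl rfl
  refine (hset.seq (T' := N * (b.cost + 4 + (T + 6)) + (b.cost + 4)) (Q := I N) ?_).mono
    (by nlinarith) fun _ _ h => h
  rintro _ hs₁ rfl
  refine (Runs.loop (fun j s => I j s ∧ s.int v 0 = j ∧ j ≤ N) N (T + 6) ?_ ?_).mono ?_ ?_
  · exact ⟨h₀, by simp [Store.setInt_int_self], Nat.zero_le _⟩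
  · rintro j s hs ⟨hI, hj, -⟩ hh
    have hs' : AgreeOff (.forLoop v b p) s₀ s := hs₁.seq hs.loop
    have hjN : j < N := by simpa [Test.Holds, IntExp.eval, hb s hs', hj] using hh
    refine ⟨hjN, (hstep j s hjN hs' hj hI).seq fun s' hss' hI' => ?_⟩
    refine .of_loopFree rfl (by simp [Program.maxCost, IntExp.cost]) ?_
    have hv' : s'.int v 0 = j := by rw [hss'.int v hv, hj]
    simpa [Program.run, IntExp.eval, hv', Store.setInt_int_self] using ⟨hI', hjN⟩
  · simp only [Test.cost, IntExp.cost]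
    nlinarith
  · rintro s hs ⟨j, ⟨hI, hj, hjN⟩, hh⟩
    have hNj : N ≤ j := by simpa [Test.Holds, IntExp.eval, hb s (hs₁.seq hs), hj] using hh
    rwa [le_antisymm hNj hjN]

end RealRAM

theorem abs_sub_le_of_le_iff_le {R : Type*} [CommRing R] [LinearOrder R] [IsStrictOrderedRing R]
    {a b r s t d : R} (ha : r ≤ a ∧ a ≤ t) (hb : r ≤ b ∧ b ≤ t)
    (hrs : s ≤ r + d) (hst : t ≤ s + d) (h : a ≤ s ↔ b ≤ s) : |a - b| ≤ d := by
  rw [abs_le]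
  by_cases has : a ≤ s
  · have := h.1 has
    constructor <;> linarith
  · have := mt h.2 has
    constructor <;> linarith

/-- The task of covering `n` points by `K` packings of unit disks taken from `m` given ones. An item
is a pair of a disk and a colour; the `e`-th of the `m * K` items is the disk `e % m` with the
colour `e / m`. -/
structure CoverTask where
  n : ℕ
  m : ℕ
  K : ℕ
  px : ℕ → ℝ
  py : ℕ → ℝ
  dx : ℕ → ℝ
  dy : ℕ → ℝ

/-- The task of covering the points in the horizontal strip of the height `7 / 5` that begins at the
height `y₀`. -/
structure StripTask extends CoverTask where
  y₀ : ℝ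

/-- The breadth-first queue of the search for a solution of a strip task: the sets of items found so
far, each with the item that was added last. The set number `0` is the empty set, whose last item
is meaningless. -/
structure SearchQueue where
  set : ℕ → Finset ℕ
  last : ℕ → ℕ
  size : ℕ

namespace SearchQueue

/-- The queue that consists of the empty set. -/
def initial : SearchQueue := ⟨fun _ => ∅, fun _ => 0, 1⟩

/-- The queue in which the set number `q`, enlarged by the item `f`, is put at the end. -/
def push (Q : SearchQueue) (q f : ℕ) : SearchQueue where
  set := Function.update Q.set Q.size (insert f (Q.set q))
  last := Function.update Q.last Q.size f
  size := Q.size + 1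

theorem push_set_size (Q : SearchQueue) (q f : ℕ) :
    (Q.push q f).set Q.size = insert f (Q.set q) := Function.update_self _ _ _

theorem push_last_size (Q : SearchQueue) (q f : ℕ) : (Q.push q f).last Q.size = f :=
  Function.update_self _ _ _

theorem push_set_of_lt (Q : SearchQueue) (q f : ℕ) {r : ℕ} (hr : r < Q.size) :
    (Q.push q f).set r = Q.set r := Function.update_of_ne hr.ne _ _

theorem push_last_of_lt (Q : SearchQueue) (q f : ℕ) {r : ℕ} (hr : r < Q.size) :
    (Q.push q f).last r = Q.last r := Function.update_of_ne hr.ne _ _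

end SearchQueue

namespace CoverTask

variable (B : CoverTask)

/-- The number of items. -/
abbrev numItems : ℕ := B.m * B.K

/-- The time, up to a constant factor, of the search for a solution of a strip task: there are at
most `(m + 1) ^ (4 * K)` windows. -/
abbrev searchTime : ℕ :=
  (B.m + 1) ^ (4 * B.K) * ((B.numItems + 1) * (B.numItems + B.n + 1))

/-- The abscissa of the centre of an item. -/
def x (e : ℕ) : ℝ := B.dx (e % B.m)

/-- The ordinate of the centre of an item. -/
def y (e : ℕ) : ℝ := B.dy (e % B.m)

/-- The items have the same colour and their disks intersect. -/
def Conflict (e f : ℕ) : Prop :=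
  e / B.m = f / B.m ∧ (B.x e - B.x f) * (B.x e - B.x f) + (B.y e - B.y f) * (B.y e - B.y f) ≤ 4

/-- The disk of the item `e` contains the point `p`. -/
def Covers (e p : ℕ) : Prop :=
  (B.px p - B.x e) * (B.px p - B.x e) + (B.py p - B.y e) * (B.py p - B.y e) ≤ 1

/-- The items of `G` form packings that cover all the points. -/
structure Solution (G : Finset ℕ) : Prop where
  lt : ∀ e ∈ G, e < B.numItems
  not_conflict : ∀ e ∈ G, ∀ f ∈ G, e ≠ f → ¬ B.Conflict e f
  covers : ∀ p < B.n, ∃ e ∈ G, B.Covers e p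

/-- The task for the strip that begins at the height `y₀`. -/
def strip (y₀ : ℝ) : StripTask := ⟨B, y₀⟩

variable {B}

theorem numItems_add_n_le_searchTime : B.numItems + B.n + 1 ≤ B.searchTime :=
  (Nat.le_mul_of_pos_left _ (Nat.succ_pos _)).trans
    (Nat.le_mul_of_pos_left _ (Nat.pow_pos (Nat.succ_pos _)))

theorem conflict_self (e : ℕ) : B.Conflict e e := by simp [Conflict]

theorem Conflict.symm {e f : ℕ} (h : B.Conflict e f) : B.Conflict f e :=
  ⟨h.1.symm, by linarith [h.2]⟩

theorem Conflict.sub_two_le {e f : ℕ} (h : B.Conflict e f) : B.x f - 2 ≤ B.x e := by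
  nlinarith [h.2, mul_self_nonneg (B.y e - B.y f)]

theorem Conflict.y_le {e f : ℕ} (h : B.Conflict e f) : B.y f ≤ B.y e + 2 := by
  nlinarith [h.2, mul_self_nonneg (B.x e - B.x f)]

theorem Covers.abs_x_le {e p : ℕ} (h : B.Covers e p) : |B.px p - B.x e| ≤ 1 := by
  rw [← sq_le_one_iff_abs_le_one, sq]
  exact (le_add_of_nonneg_right (mul_self_nonneg _)).trans h

theorem Covers.abs_y_le {e p : ℕ} (h : B.Covers e p) : |B.py p - B.y e| ≤ 1 := by
  rw [← sq_le_one_iff_abs_le_one, sq]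
  exact (le_add_of_nonneg_left (mul_self_nonneg _)).trans h

end CoverTask

namespace StripTask

open CoverTask

variable (S : StripTask)

/-- The point `p` lies in the strip. -/
def Needs (p : ℕ) : Prop := S.y₀ ≤ S.py p ∧ S.py p < S.y₀ + 7 / 5

/-- The centre of the item is at distance at most `1` from the strip. -/
def Relevant (e : ℕ) : Prop := S.y₀ - 1 ≤ S.y e ∧ S.y e ≤ S.y₀ + 12 / 5

/-- The point `p` is covered by the set `A` of items unless it lies outside the strip. -/
def CoveredBy (A : Finset ℕ) (p : ℕ) : Prop := S.Needs p → ∃ e ∈ A, S.Covers e p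

/-- A set of relevant items without conflicts. -/
structure Independent (A : Finset ℕ) : Prop where
  lt : ∀ e ∈ A, e < S.numItems
  relevant : ∀ e ∈ A, S.Relevant e
  not_conflict : ∀ e ∈ A, ∀ f ∈ A, e ≠ f → ¬ S.Conflict e f

/-- A set of items that solves the task. -/
structure Solution (A : Finset ℕ) : Prop extends S.Independent A where
  covered : ∀ p < S.n, S.CoveredBy A p

/-- The search, which proceeds from the left to the right, may add the item `f` to the set `A`: the
points that no later item can cover are covered by `A`. -/
structure Extends (A : Finset ℕ) (f : ℕ) : Prop where
  relevant : S.Relevant f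
  le : ∀ e ∈ A, S.x e ≤ S.x f
  not_conflict : ∀ e ∈ A, ¬ S.Conflict e f
  covered : ∀ p < S.n, S.px p < S.x f - 1 → S.CoveredBy A p

open scoped Classical in
/-- The part of `A` on which the continuation of the search after the item `f` depends: the items
further to the left can neither conflict with later ones nor cover points that are still open. -/
noncomputable def window (A : Finset ℕ) (f : ℕ) : Finset ℕ := A.filter fun e => S.x f - 2 ≤ S.x e

/-- What is known about a nonempty set that the search has found by adding `l` last. -/
structure Reached (A : Finset ℕ) (l : ℕ) : Prop extends S.Independent A where
  last_mem : l ∈ A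
  le_last : ∀ e ∈ A, S.x e ≤ S.x l
  covered : ∀ p < S.n, S.px p < S.x l - 1 → S.CoveredBy A p

/-- The invariant of the search: all the sets in the queue are admissible, and no two of them have
the same window. -/
structure Valid (Q : SearchQueue) : Prop where
  pos : 0 < Q.size
  zero : Q.set 0 = ∅
  reached : ∀ q < Q.size, q ≠ 0 → S.Reached (Q.set q) (Q.last q)
  window_inj : ∀ q < Q.size, ∀ r < Q.size, q ≠ 0 → r ≠ 0 →
    S.window (Q.set q) (Q.last q) = S.window (Q.set r) (Q.last r) → q = r

/-- The window of the extension of `A` by `f` is the window of a set in the queue. -/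
def Represented (Q : SearchQueue) (A : Finset ℕ) (f : ℕ) : Prop :=
  ∃ q < Q.size, q ≠ 0 ∧ S.window (Q.set q) (Q.last q) = S.window (insert f A) f

variable {S}

theorem mem_window {A : Finset ℕ} {e f : ℕ} : e ∈ S.window A f ↔ e ∈ A ∧ S.x f - 2 ≤ S.x e := by
  simp [window]

theorem independent_empty : S.Independent ∅ := ⟨by simp, by simp, by simp⟩

theorem Extends.notMem {A : Finset ℕ} {f : ℕ} (h : S.Extends A f) : f ∉ A :=
  fun hf => h.not_conflict f hf (conflict_self f)

theorem Independent.insert {A : Finset ℕ} {f : ℕ} (hA : S.Independent A) (hf : f < S.numItems)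
    (h : S.Extends A f) : S.Independent (insert f A) where
  lt := by simpa using ⟨hf, hA.lt⟩
  relevant := by simpa using ⟨h.relevant, hA.relevant⟩
  not_conflict := by
    intro a ha b hb hab
    rcases Finset.mem_insert.1 ha with rfl | ha' <;>
      rcases Finset.mem_insert.1 hb with rfl | hb'
    · exact absurd rfl hab
    · exact fun hc => h.not_conflict b hb' hc.symm
    · exact h.not_conflict a ha'
    · exact hA.not_conflict a ha' b hb' hab

theorem Independent.reached_insert {A : Finset ℕ} {f : ℕ} (hA : S.Independent A)
    (hf : f < S.numItems) (h : S.Extends A f) : S.Reached (Insert.insert f A) f where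
  toIndependent := hA.insert hf h
  last_mem := Finset.mem_insert_self _ _
  le_last := by simpa using h.le
  covered p hp hlt hneed :=
    (h.covered p hp hlt hneed).imp fun _ he => ⟨Finset.mem_insert_of_mem he.1, he.2⟩

theorem Reached.x_last_eq {A B : Finset ℕ} {l f : ℕ} (hA : S.Reached A l)
    (hB : ∀ e ∈ B, S.x e ≤ S.x f) (h : S.window A l = S.window (insert f B) f) :
    S.x l = S.x f := by
  apply le_antisymm
  · have hl : l ∈ S.window (insert f B) f := h ▸ mem_window.2 ⟨hA.last_mem, by linarith⟩
    rw [mem_window, Finset.mem_insert] at hl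
    rcases hl.1 with rfl | hlB
    · exact le_rfl
    · exact hB l hlB
  · have hf : f ∈ S.window A l := h ▸ mem_window.2 ⟨Finset.mem_insert_self _ _, by linarith⟩
    exact hA.le_last f (mem_window.1 hf).1

namespace Valid

variable {Q : SearchQueue}

theorem initial : S.Valid .initial where
  pos := Nat.one_pos
  zero := rfl
  reached _ hq hq0 := absurd (Nat.lt_one_iff.1 hq) hq0
  window_inj _ hq _ _ hq0 := absurd (Nat.lt_one_iff.1 hq) hq0

theorem independent (hQ : S.Valid Q) {q : ℕ} (hq : q < Q.size) : S.Independent (Q.set q) := by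
  obtain rfl | hq0 := eq_or_ne q 0
  · exact hQ.zero ▸ independent_empty
  · exact (hQ.reached q hq hq0).toIndependent

theorem push (hQ : S.Valid Q) {q f : ℕ} (hq : q < Q.size) (hf : f < S.numItems)
    (hext : S.Extends (Q.set q) f) (hnew : ¬ S.Represented Q (Q.set q) f) :
    S.Valid (Q.push q f) := by
  refine ⟨Nat.succ_pos _, by rw [Q.push_set_of_lt q f hQ.pos, hQ.zero], fun r hr hr0 => ?_,
    fun r hr r' hr' hr0 hr0' h => ?_⟩
  · rcases Nat.lt_succ_iff_lt_or_eq.1 hr with hr | rfl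
    · rw [Q.push_set_of_lt q f hr, Q.push_last_of_lt q f hr]
      exact hQ.reached r hr hr0
    · rw [Q.push_set_size, Q.push_last_size]
      exact (hQ.independent hq).reached_insert hf hext
  · rcases Nat.lt_succ_iff_lt_or_eq.1 hr with hr | rfl <;>
      rcases Nat.lt_succ_iff_lt_or_eq.1 hr' with hr' | rfl
    · rw [Q.push_set_of_lt q f hr, Q.push_last_of_lt q f hr, Q.push_set_of_lt q f hr',
        Q.push_last_of_lt q f hr'] at h
      exact hQ.window_inj r hr r' hr' hr0 hr0' h
    · rw [Q.push_set_of_lt q f hr, Q.push_last_of_lt q f hr, Q.push_set_size,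
        Q.push_last_size] at h
      exact absurd ⟨r, hr, hr0, h⟩ hnew
    · rw [Q.push_set_of_lt q f hr', Q.push_last_of_lt q f hr', Q.push_set_size,
        Q.push_last_size] at h
      exact absurd ⟨r', hr', hr0', h.symm⟩ hnew
    · rfl

end Valid

theorem represented_push (Q : SearchQueue) (hQ : Q.size ≠ 0) (q f : ℕ) :
    S.Represented (Q.push q f) (Q.set q) f :=
  ⟨Q.size, Nat.lt_succ_self _, hQ, by rw [Q.push_set_size, Q.push_last_size]⟩

/-! ### Completeness of the search -/

/-- The set `A` in the queue is as good as the part `G` of the solution `F` for the continuation of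
the search from the abscissa `T`. -/
structure Simulates (F G A : Finset ℕ) (T : ℝ) : Prop where
  subset : G ⊆ F
  le : ∀ e ∈ A, S.x e ≤ T
  ge : ∀ f ∈ F, f ∉ G → T ≤ S.x f
  mem_iff : ∀ e, T - 2 ≤ S.x e → (e ∈ A ↔ e ∈ G)
  covered : ∀ p < S.n, S.px p < T - 1 → S.CoveredBy A p

theorem exists_simulates_empty (F : Finset ℕ) : ∃ T, S.Simulates F ∅ ∅ T := by
  obtain ⟨X, hX⟩ := (F.image S.x).bddBelow
  obtain ⟨Y, hY⟩ := ((Finset.range S.n).image S.px).bddBelow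
  refine ⟨min X Y, by simp, by simp, fun f hf _ => ?_, by simp, fun p hp hlt => ?_⟩
  · exact (min_le_left X Y).trans (hX (by simpa using ⟨f, hf, rfl⟩))
  · have : Y ≤ S.px p := hY (by simpa using ⟨p, hp, rfl⟩)
    linarith [min_le_right X Y]

namespace Simulates

variable {F G A : Finset ℕ} {T : ℝ}

theorem covered_of_solution (h : S.Simulates F G A T) (hF : S.Solution F) {p : ℕ} (hp : p < S.n)
    (hG : ∀ f ∈ F, f ∉ G → S.px p < S.x f - 1) : S.CoveredBy A p := by
  intro hneed
  by_cases hpT : S.px p < T - 1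
  · exact h.covered p hp hpT hneed
  · obtain ⟨g, hgF, hgp⟩ := hF.covered p hp hneed
    have hgG : g ∈ G := by
      by_contra hgG
      linarith [hG g hgF hgG, abs_le.1 hgp.abs_x_le]
    exact ⟨g, (h.mem_iff g (by linarith [abs_le.1 hgp.abs_x_le])).2 hgG, hgp⟩

theorem extends_of_minimal (h : S.Simulates F G A T) (hF : S.Solution F) {f : ℕ} (hf : f ∈ F \ G)
    (hmin : ∀ f' ∈ F \ G, S.x f ≤ S.x f') : S.Extends A f := by
  obtain ⟨hfF, hfG⟩ := Finset.mem_sdiff.1 hf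
  have hTf := h.ge f hfF hfG
  refine ⟨hF.relevant f hfF, fun e he => (h.le e he).trans hTf, fun e he hc => ?_,
    fun p hp hlt => h.covered_of_solution hF hp fun f' hf'F hf'G => ?_⟩
  · have heG : e ∈ G := (h.mem_iff e (by linarith [hc.sub_two_le])).1 he
    exact hF.not_conflict e (h.subset heG) f hfF (by rintro rfl; exact hfG heG) hc
  · linarith [hmin f' (Finset.mem_sdiff.2 ⟨hf'F, hf'G⟩)]

theorem insert_of_window_eq (h : S.Simulates F G A T) {f : ℕ} (hf : f ∈ F \ G)
    (hmin : ∀ f' ∈ F \ G, S.x f ≤ S.x f') (hext : S.Extends A f) {B : Finset ℕ} {l : ℕ}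
    (hB : S.Reached B l) (hw : S.window B l = S.window (insert f A) f) :
    S.Simulates F (insert f G) B (S.x f) := by
  obtain ⟨hfF, hfG⟩ := Finset.mem_sdiff.1 hf
  have hlast := hB.x_last_eq hext.le hw
  refine ⟨Finset.insert_subset hfF h.subset, hlast ▸ hB.le_last, fun f' hf'F hf'G => ?_,
    fun e he => ?_, hlast ▸ hB.covered⟩
  · rw [Finset.mem_insert, not_or] at hf'G
    exact hmin f' (Finset.mem_sdiff.2 ⟨hf'F, hf'G.2⟩)
  · have hmem : e ∈ S.window B l ↔ e ∈ S.window (insert f A) f := by rw [hw]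
    rw [mem_window, mem_window, hlast, and_iff_left he, and_iff_left he] at hmem
    rw [hmem, Finset.mem_insert, Finset.mem_insert,
      h.mem_iff e (by linarith [h.ge f hfF hfG])]

end Simulates

theorem Valid.exists_simulates {Q : SearchQueue} (hQ : S.Valid Q)
    (hclosed : ∀ q < Q.size, ∀ f < S.numItems, S.Extends (Q.set q) f →
      S.Represented Q (Q.set q) f) {F : Finset ℕ} (hF : S.Solution F) {j : ℕ} (hj : j ≤ F.card) :
    ∃ G T, ∃ q < Q.size, G.card = j ∧ S.Simulates F G (Q.set q) T := by
  induction j with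
  | zero =>
    obtain ⟨T, hT⟩ := exists_simulates_empty (S := S) F
    exact ⟨∅, T, 0, hQ.pos, rfl, hQ.zero ▸ hT⟩
  | succ j ih =>
    obtain ⟨G, T, q, hq, hGj, hG⟩ := ih (by lia)
    have hne : (F \ G).Nonempty := by
      rw [← Finset.card_pos, Finset.card_sdiff_of_subset hG.subset]
      lia
    obtain ⟨f, hf, hmin⟩ := Finset.exists_min_image (F \ G) S.x hne
    obtain ⟨hfF, hfG⟩ := Finset.mem_sdiff.1 hf
    have hext := hG.extends_of_minimal hF hf hmin
    obtain ⟨r, hr, hr0, hw⟩ := hclosed q hq f (hF.lt f hfF) hext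
    exact ⟨insert f G, S.x f, r, hr, by rw [Finset.card_insert_of_notMem hfG, hGj],
      hG.insert_of_window_eq hf hmin hext (hQ.reached r hr hr0) hw⟩

theorem Valid.exists_covering {Q : SearchQueue} (hQ : S.Valid Q)
    (hclosed : ∀ q < Q.size, ∀ f < S.numItems, S.Extends (Q.set q) f →
      S.Represented Q (Q.set q) f) {F : Finset ℕ} (hF : S.Solution F) :
    ∃ q < Q.size, ∀ p < S.n, S.CoveredBy (Q.set q) p := by
  obtain ⟨G, T, q, hq, hGF, hG⟩ := hQ.exists_simulates hclosed hF le_rfl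
  obtain rfl := Finset.eq_of_subset_of_card_le hG.subset hGF.ge
  exact ⟨q, hq, fun p hp => hG.covered_of_solution hF hp fun f hfF hfG => absurd hfF hfG⟩

/-! ### The number of windows -/

variable (S) in
open scoped Classical in
/-- The cell that contains the centre of an item `e` of the window `[X - 2, X]`; a cell has the
width `1` and the height `17 / 10`, hence a diameter less than `2`. -/
noncomputable def cell (X : ℝ) (e : ℕ) : Bool × Bool :=
  (decide (S.x e ≤ X - 1), decide (S.y e ≤ S.y₀ + 7 / 10))

theorem conflict_of_cell_eq {X : ℝ} {e f : ℕ} (he : S.Relevant e) (hf : S.Relevant f)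
    (hxe : X - 2 ≤ S.x e ∧ S.x e ≤ X) (hxf : X - 2 ≤ S.x f ∧ S.x f ≤ X)
    (hc : e / S.m = f / S.m) (h : S.cell X e = S.cell X f) : S.Conflict e f := by
  refine ⟨hc, ?_⟩
  simp only [cell, Prod.mk.injEq, decide_eq_decide] at h
  have hx : |S.x e - S.x f| ≤ 1 :=
    abs_sub_le_of_le_iff_le hxe hxf (by linarith) (by linarith) h.1
  have hy : |S.y e - S.y f| ≤ 17 / 10 :=
    abs_sub_le_of_le_iff_le he hf (by linarith) (by linarith) h.2
  nlinarith [abs_mul_abs_self (S.x e - S.x f), abs_mul_abs_self (S.y e - S.y f),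
    abs_nonneg (S.x e - S.x f), abs_nonneg (S.y e - S.y f)]

/-- A table with at most one disk for each colour and each cell. -/
abbrev Table (S : StripTask) : Type := Fin S.K × Bool × Bool → Option (Fin S.m)

open scoped Classical in
/-- The set of the items that occur in a table. -/
noncomputable def Table.items (g : S.Table) : Finset ℕ :=
  (Finset.range S.numItems).filter fun e => ∃ c b d, g (c, b) = some d ∧ e / S.m = c ∧ e % S.m = d

theorem Independent.injOn_window {A : Finset ℕ} (hA : S.Independent A) {l : ℕ}
    (hl : ∀ e ∈ A, S.x e ≤ S.x l) :
    Set.InjOn (fun e => (e / S.m, S.cell (S.x l) e)) (S.window A l) := by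
  intro e he f hf hef
  obtain ⟨heA, hel⟩ := mem_window.1 he
  obtain ⟨hfA, hfl⟩ := mem_window.1 hf
  obtain ⟨hc, hcell⟩ := Prod.ext_iff.1 hef
  by_contra hne
  exact hA.not_conflict e heA f hfA hne (conflict_of_cell_eq (hA.relevant e heA)
    (hA.relevant f hfA) ⟨hel, hl e heA⟩ ⟨hfl, hl f hfA⟩ hc hcell)

theorem Independent.exists_table {A : Finset ℕ} (hA : S.Independent A) {l : ℕ}
    (hl : ∀ e ∈ A, S.x e ≤ S.x l) : ∃ g : S.Table, g.items = S.window A l := by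
  classical
  let entry (c : Fin S.K × Bool × Bool) (d : Fin S.m) : Prop :=
    ∃ e ∈ S.window A l, e / S.m = c.1 ∧ S.cell (S.x l) e = c.2 ∧ e % S.m = d
  refine ⟨fun c => if h : ∃ d, entry c d then some h.choose else none, Finset.ext fun e => ?_⟩
  simp only [Table.items, Finset.mem_filter, Finset.mem_range]
  constructor
  · rintro ⟨-, c, b, d, hg, hec, hed⟩
    split_ifs at hg with h
    obtain ⟨f, hf, hfc, -, hfd⟩ := h.choose_spec
    rw [Option.some_inj.1 hg] at hfd
    have hef : e = f := by
      rw [← Nat.div_add_mod e S.m, ← Nat.div_add_mod f S.m, hec, hed, hfc, hfd]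
    rwa [hef]
  · intro he
    have hlt := hA.lt e (mem_window.1 he).1
    have hm : 0 < S.m := Nat.pos_of_mul_pos_right (Nat.zero_lt_of_lt hlt)
    have hentry : ∃ d, entry (⟨e / S.m, Nat.div_lt_of_lt_mul hlt⟩, S.cell (S.x l) e) d :=
      ⟨⟨e % S.m, Nat.mod_lt _ hm⟩, e, he, rfl, rfl, rfl⟩
    obtain ⟨f, hf, hfc, hfcell, hfd⟩ := hentry.choose_spec
    have hfe : f = e := hA.injOn_window hl hf he (Prod.ext hfc hfcell)
    exact ⟨hlt, _, _, _, dif_pos hentry, rfl, by rw [← hfd, hfe]⟩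

theorem Valid.size_le {Q : SearchQueue} (hQ : S.Valid Q) :
    Q.size ≤ 1 + (S.m + 1) ^ (4 * S.K) := by
  classical
  have hmaps : ∀ q ∈ Finset.Ico 1 Q.size,
      S.window (Q.set q) (Q.last q) ∈ Finset.univ.image (Table.items (S := S)) := by
    intro q hq
    obtain ⟨hq1, hqt⟩ := Finset.mem_Ico.1 hq
    have hr := hQ.reached q hqt (by lia)
    obtain ⟨g, hg⟩ := hr.exists_table hr.le_last
    exact Finset.mem_image.2 ⟨g, Finset.mem_univ _, hg⟩
  have hinj : Set.InjOn (fun q => S.window (Q.set q) (Q.last q)) (Finset.Ico 1 Q.size) := by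
    intro q hq r hr h
    have hq' := Finset.mem_Ico.1 hq
    have hr' := Finset.mem_Ico.1 hr
    exact hQ.window_inj q hq'.2 r hr'.2 (by lia) (by lia) h
  have hcard : Fintype.card S.Table = (S.m + 1) ^ (4 * S.K) := by
    simp [Fintype.card_pi, mul_comm]
  have hle := (Finset.card_le_card_of_injOn _ hmaps hinj).trans Finset.card_image_le
  rw [Nat.card_Ico, Finset.card_univ, hcard] at hle
  lia

end StripTask

/-! ### The sequence of strips -/

/-- The strips that have been processed: the strip number `i` begins at the height `base i` and is
covered by the items of `items i`. -/
structure StripSequence where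
  base : ℕ → ℝ
  items : ℕ → Finset ℕ
  length : ℕ

namespace StripSequence

/-- The sequence without strips. -/
def empty : StripSequence := ⟨fun _ => 0, fun _ => ∅, 0⟩

/-- The sequence with a further strip at the end. -/
def push (Z : StripSequence) (y : ℝ) (A : Finset ℕ) : StripSequence where
  base := Function.update Z.base Z.length y
  items := Function.update Z.items Z.length A
  length := Z.length + 1

variable (Z : StripSequence) (y : ℝ) (A : Finset ℕ)

theorem push_base_length : (Z.push y A).base Z.length = y := Function.update_self _ _ _

theorem push_items_length : (Z.push y A).items Z.length = A := Function.update_self _ _ _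

theorem push_base_of_lt {i : ℕ} (hi : i < Z.length) : (Z.push y A).base i = Z.base i :=
  Function.update_of_ne hi.ne _ _

theorem push_items_of_lt {i : ℕ} (hi : i < Z.length) : (Z.push y A).items i = Z.items i :=
  Function.update_of_ne hi.ne _ _

end StripSequence

namespace CoverTask

variable (B : CoverTask) (Z : StripSequence)

/-- The point `p` lies above all the strips. -/
def Above (p : ℕ) : Prop := ∀ i < Z.length, Z.base i + 7 / 5 ≤ B.py p

/-- The heights of those of the first `j` points that lie above all the strips. -/
def heightsAbove (j : ℕ) : Set ℝ := B.py '' {p | p < j ∧ B.Above Z p}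

/-- The invariant of the greedy choice of the strips. -/
structure ValidStrips : Prop where
  gap : ∀ i' < Z.length, ∀ i < i', Z.base i + 7 / 5 ≤ Z.base i'
  exists_point : ∀ i < Z.length, ∃ p < B.n, Z.base i = B.py p
  independent : ∀ i < Z.length, (B.strip (Z.base i)).Independent (Z.items i)
  covered : ∀ p < B.n, ¬ B.Above Z p → ∃ i < Z.length, ∃ e ∈ Z.items i, B.Covers e p

/-- The output `out` arises from `out₀` when the disks of the items of `A` are coloured with the
palette number `r`. -/
structure Overwrites (out₀ : ℕ → ℕ) (r : ℕ) (A : Finset ℕ) (out : ℕ → ℕ) : Prop where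
  pos : ∀ e ∈ A, 0 < out (e % B.m)
  eq_or : ∀ d, out d = out₀ d ∨ ∃ e ∈ A, e % B.m = d ∧ out d = r * B.K + e / B.m + 1

/-- The output consists of the disks of the items that cover the strips; the strips with the numbers
`i`, `i + 4`, `i + 8`, … share a palette of `K` colours. -/
structure OutputOf (out : ℕ → ℕ) : Prop where
  pos : ∀ i < Z.length, ∀ e ∈ Z.items i, 0 < out (e % B.m)
  color : ∀ d, 0 < out d →
    ∃ i < Z.length, ∃ e ∈ Z.items i, e % B.m = d ∧ out d = i % 4 * B.K + e / B.m + 1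

variable {B Z}

theorem Solution.exists_strip_solution {G : Finset ℕ} (hG : B.Solution G) (y₀ : ℝ) :
    ∃ F, (B.strip y₀).Solution F := by
  classical
  refine ⟨G.filter (B.strip y₀).Relevant, ⟨fun e he => ?_, fun e he => ?_,
    fun e he f hf => ?_⟩, fun p hp hneed => ?_⟩
  · exact hG.lt e (Finset.mem_filter.1 he).1
  · exact (Finset.mem_filter.1 he).2
  · exact hG.not_conflict e (Finset.mem_filter.1 he).1 f (Finset.mem_filter.1 hf).1
  · obtain ⟨e, he, hep⟩ := hG.covers p hp
    obtain ⟨hlow, hhigh⟩ : y₀ ≤ B.py p ∧ B.py p < y₀ + 7 / 5 := hneed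
    have hdist := abs_le.1 hep.abs_y_le
    have hrel : y₀ - 1 ≤ B.y e ∧ B.y e ≤ y₀ + 12 / 5 := ⟨by linarith, by linarith⟩
    exact ⟨e, Finset.mem_filter.2 ⟨he, hrel⟩, hep⟩

theorem Solution.numItems_pos {G : Finset ℕ} (hG : B.Solution G) (hn : 0 < B.n) :
    0 < B.numItems := by
  obtain ⟨e, he, -⟩ := hG.covers 0 hn
  exact Nat.zero_lt_of_lt (hG.lt e he)

theorem heightsAbove_succ_of_above {j : ℕ} (hj : B.Above Z j) :
    B.heightsAbove Z (j + 1) = insert (B.py j) (B.heightsAbove Z j) := by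
  rw [heightsAbove, heightsAbove, ← Set.image_insert_eq]
  congr 1
  ext p
  simp only [Set.mem_ofPred_eq, Set.mem_insert_iff, Nat.lt_succ_iff_lt_or_eq]
  grind

theorem heightsAbove_succ_of_not_above {j : ℕ} (hj : ¬ B.Above Z j) :
    B.heightsAbove Z (j + 1) = B.heightsAbove Z j := by
  rw [heightsAbove, heightsAbove]
  congr 1
  ext p
  simp only [Set.mem_ofPred_eq, Nat.lt_succ_iff_lt_or_eq]
  grind

theorem above_push {y : ℝ} {A : Finset ℕ} {p : ℕ} :
    B.Above (Z.push y A) p ↔ B.Above Z p ∧ y + 7 / 5 ≤ B.py p := by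
  refine Nat.forall_lt_succ_right.trans (and_congr (forall₂_congr fun i hi => ?_) ?_)
  · rw [Z.push_base_of_lt y A hi]
  · rw [Z.push_base_length]

theorem above_push_iff_of_isLeast {y : ℝ} (hy : IsLeast (B.heightsAbove Z B.n) y) {A : Finset ℕ}
    {p : ℕ} : B.Above (Z.push y A) p ↔ y + 7 / 5 ≤ B.py p := by
  obtain ⟨⟨q, ⟨-, hq⟩, rfl⟩, -⟩ := hy
  refine above_push.trans (and_iff_right_of_imp fun hp i hi => ?_)
  linarith [hq i hi]

namespace ValidStrips

theorem empty : B.ValidStrips .empty where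
  gap _ h := absurd h (Nat.not_lt_zero _)
  exists_point _ h := absurd h (Nat.not_lt_zero _)
  independent _ h := absurd h (Nat.not_lt_zero _)
  covered _ _ h := absurd (fun _ h' => absurd h' (Nat.not_lt_zero _)) h

theorem push (h : B.ValidStrips Z) {y : ℝ} (hy : IsLeast (B.heightsAbove Z B.n) y) {A : Finset ℕ}
    (hA : (B.strip y).Solution A) : B.ValidStrips (Z.push y A) := by
  refine ⟨Nat.forall_lt_succ_right.2 ⟨fun i' hi' i hi => ?_, fun i hi => ?_⟩,
    Nat.forall_lt_succ_right.2 ⟨fun i hi => ?_, ?_⟩,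
    Nat.forall_lt_succ_right.2 ⟨fun i hi => ?_, ?_⟩, fun p hp hopen => ?_⟩
  · rw [Z.push_base_of_lt y A hi', Z.push_base_of_lt y A (hi.trans hi')]
    exact h.gap i' hi' i hi
  · obtain ⟨p, ⟨-, habove⟩, hyp⟩ := hy.1
    rw [Z.push_base_of_lt y A hi, Z.push_base_length, ← hyp]
    exact habove i hi
  · rw [Z.push_base_of_lt y A hi]
    exact h.exists_point i hi
  · rw [Z.push_base_length]
    obtain ⟨p, ⟨hp, -⟩, hyp⟩ := hy.1
    exact ⟨p, hp, hyp.symm⟩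
  · rw [Z.push_base_of_lt y A hi, Z.push_items_of_lt y A hi]
    exact h.independent i hi
  · rw [Z.push_base_length, Z.push_items_length]
    exact hA.toIndependent
  · by_cases habove : B.Above Z p
    · have hlt : B.py p < y + 7 / 5 := by
        rwa [above_push_iff_of_isLeast hy, not_le] at hopen
      obtain ⟨e, he, hep⟩ := hA.covered p hp ⟨hy.2 ⟨p, ⟨hp, habove⟩, rfl⟩, hlt⟩
      exact ⟨Z.length, Nat.lt_succ_self _, e, by rwa [Z.push_items_length], hep⟩
    · obtain ⟨i, hi, e, he, hep⟩ := h.covered p hp habove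
      exact ⟨i, Nat.lt_succ_of_lt hi, e, by rwa [Z.push_items_of_lt y A hi], hep⟩

theorem base_add_le (h : B.ValidStrips Z) {i i' : ℕ} (hle : i ≤ i') (hi' : i' < Z.length) :
    Z.base i + 7 / 5 * ((i' : ℝ) - i) ≤ Z.base i' := by
  induction i', hle using Nat.le_induction with
  | base => simp
  | succ r _ ih =>
    have hgap := h.gap (r + 1) hi' r (Nat.lt_succ_self r)
    have := ih (Nat.lt_of_succ_lt hi')
    push_cast
    linarith

theorem length_le_n (h : B.ValidStrips Z) : Z.length ≤ B.n := by
  choose p hp hbase using fun i : Fin Z.length => h.exists_point i i.2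
  have hinj : Function.Injective fun i => (⟨p i, hp i⟩ : Fin B.n) := by
    refine .of_lt_imp_ne fun i i' hlt heq => ?_
    have hgap := h.gap i' i'.2 i hlt
    rw [hbase i, hbase i', Fin.mk.inj heq] at hgap
    linarith
  simpa using Fintype.card_le_of_injective _ hinj

theorem length_le_two_mul (h : B.ValidStrips Z) {G : Finset ℕ} (hG : B.Solution G) :
    Z.length ≤ 2 * B.m := by
  have hex : ∀ i : Fin Z.length, ∃ d : Fin B.m, |Z.base i - B.dy d| ≤ 1 := by
    intro i
    obtain ⟨p, hp, hbase⟩ := h.exists_point i i.2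
    obtain ⟨e, he, hep⟩ := hG.covers p hp
    have hm : 0 < B.m := Nat.pos_of_mul_pos_right (Nat.zero_lt_of_lt (hG.lt e he))
    exact ⟨⟨e % B.m, Nat.mod_lt _ hm⟩, hbase ▸ hep.abs_y_le⟩
  choose d hd using hex
  have hinj : Function.Injective fun i : Fin Z.length =>
      ((⟨i % 2, Nat.mod_lt _ two_pos⟩ : Fin 2), d i) := by
    refine .of_lt_imp_ne fun i i' hlt heq => ?_
    obtain ⟨hmod, hdisk⟩ := Prod.mk.inj heq
    have hgap := h.base_add_le hlt.le i'.2
    have htwo : (i : ℝ) + 2 ≤ i' := by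
      have : (i : ℕ) % 2 = i' % 2 := Fin.mk.inj hmod
      exact_mod_cast (by lia : (i : ℕ) + 2 ≤ i')
    have hdi := abs_le.1 (hd i)
    have hdi' := abs_le.1 (hd i')
    rw [hdisk] at hdi
    linarith
  simpa using Fintype.card_le_of_injective _ hinj

theorem not_conflict (h : B.ValidStrips Z) {i i' e f : ℕ} (hi : i < Z.length)
    (hi' : i' < Z.length) (hmod : i % 4 = i' % 4) (he : e ∈ Z.items i) (hf : f ∈ Z.items i')
    (hef : e ≠ f) : ¬ B.Conflict e f := by
  wlog hle : i ≤ i' generalizing i i' e f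
  · exact fun hc => this hi' hi hmod.symm hf he hef.symm (le_of_not_ge hle) hc.symm
  rcases hle.eq_or_lt with rfl | hlt
  · exact (h.independent i hi).not_conflict e he f hf hef
  · intro hc
    have hfour : (i : ℝ) + 4 ≤ i' := by exact_mod_cast (by lia : i + 4 ≤ i')
    have hgap := h.base_add_le hle hi'
    have hye : B.y e ≤ Z.base i + 12 / 5 := ((h.independent i hi).relevant e he).2
    have hyf : Z.base i' - 1 ≤ B.y f := ((h.independent i' hi').relevant f hf).1
    linarith [hc.y_le]

end ValidStrips

theorem Overwrites.insert {out₀ out : ℕ → ℕ} {r : ℕ} {A : Finset ℕ}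
    (h : B.Overwrites out₀ r A out) (e : ℕ) : B.Overwrites out₀ r (insert e A)
      (Function.update out (e % B.m) (r * B.K + e / B.m + 1)) := by
  refine ⟨fun f hf => ?_, fun d => ?_⟩
  · rcases eq_or_ne (f % B.m) (e % B.m) with heq | hne
    · simp [heq]
    · rw [Function.update_of_ne hne]
      exact h.pos f (Finset.mem_of_mem_insert_of_ne hf fun hfe => hne (hfe ▸ rfl))
  · rcases eq_or_ne d (e % B.m) with rfl | hne
    · exact .inr ⟨e, Finset.mem_insert_self e A, rfl, Function.update_self _ _ _⟩
    · rw [Function.update_of_ne hne]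
      exact (h.eq_or d).imp_right fun ⟨f, hf, hfd⟩ => ⟨f, Finset.mem_insert_of_mem hf, hfd⟩

theorem OutputOf.push {out out' : ℕ → ℕ} (h : B.OutputOf Z out) {A : Finset ℕ} (y : ℝ)
    (hA : B.Overwrites out (Z.length % 4) A out') : B.OutputOf (Z.push y A) out' := by
  refine ⟨Nat.forall_lt_succ_right.2 ⟨fun i hi e he => ?_, fun e he => ?_⟩, fun d hd => ?_⟩
  · rw [Z.push_items_of_lt y A hi] at he
    rcases hA.eq_or (e % B.m) with heq | ⟨_, _, _, heq⟩
    · exact heq ▸ h.pos i hi e he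
    · exact heq ▸ Nat.succ_pos _
  · rw [Z.push_items_length] at he
    exact hA.pos e he
  · rcases hA.eq_or d with heq | ⟨e, he, hed, heq⟩
    · obtain ⟨i, hi, e, he, hed, hcolor⟩ := h.color d (heq ▸ hd)
      exact ⟨i, Nat.lt_succ_of_lt hi, e, by rwa [Z.push_items_of_lt y A hi], hed,
        heq.trans hcolor⟩
    · exact ⟨Z.length, Nat.lt_succ_self _, e, by rwa [Z.push_items_length], hed, heq⟩

end CoverTask

namespace RealRAM

theorem AgreeOff.setInt (s : Store) (a i v : ℕ) :
    AgreeOff (.setInt a (.const i) (.const v)) s (s.setInt a i v) :=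
  (Exec.setInt a (.const i) (.const v) s).agreeOff

/-- The program assigns to none of the listed arrays of natural numbers and of real numbers. -/
def Program.keeps (p : Program) (ints reals : List ℕ) : Bool :=
  (ints.all fun a => !p.writesInt a) && reals.all fun a => !p.writesReal a

theorem AgreeOff.of_keeps {p : Program} {s s' : Store} {ints reals : List ℕ}
    (hs : AgreeOff p s s') (hp : p.keeps ints reals = true) :
    (∀ a ∈ ints, s'.int a = s.int a) ∧ ∀ a ∈ reals, s'.real a = s.real a := by
  simp only [Program.keeps, Bool.and_eq_true, List.all_eq_true, Bool.not_eq_true'] at hp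
  exact ⟨fun a ha => hs.int a (hp.1 a ha), fun a ha => hs.real a (hp.2 a ha)⟩

end RealRAM

open RealRAM

/-! ### The memory layout of the algorithm

`v…` is a scalar variable, `a…` an array. The queue of the search occupies consecutive blocks of
`aSet` (membership of the items) and of `aFlag` (which points are covered); the variables `v…Set`
and `v…Flag` hold the offsets of the blocks of a set. -/

local notation "aInput" => (0 : ℕ)
local notation "aOut" => (1 : ℕ)
local notation "vNumItems" => (2 : ℕ)
local notation "vK" => (3 : ℕ)
local notation "vE" => (4 : ℕ)
local notation "vP" => (5 : ℕ)
local notation "vF" => (6 : ℕ)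
local notation "vHead" => (7 : ℕ)
local notation "vTail" => (8 : ℕ)
local notation "vHeadSet" => (9 : ℕ)
local notation "vHeadFlag" => (10 : ℕ)
local notation "vTailSet" => (11 : ℕ)
local notation "vTailFlag" => (12 : ℕ)
local notation "vOk" => (13 : ℕ)
local notation "vKey" => (14 : ℕ)
local notation "vSolSet" => (15 : ℕ)
local notation "vStamp" => (16 : ℕ)
local notation "vFound" => (17 : ℕ)
local notation "vOffset" => (18 : ℕ)
local notation "vColor" => (19 : ℕ)
local notation "vPow" => (20 : ℕ)
local notation "aDisk" => (21 : ℕ)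
local notation "aColor" => (22 : ℕ)
local notation "aPow" => (23 : ℕ)
local notation "aSet" => (24 : ℕ)
local notation "aFlag" => (25 : ℕ)
local notation "aVisited" => (26 : ℕ)
local notation "aPointX" => (0 : ℕ)
local notation "aPointY" => (1 : ℕ)
local notation "aDiskX" => (2 : ℕ)
local notation "aDiskY" => (3 : ℕ)
local notation "vBase" => (4 : ℕ)
local notation "vNextBase" => (5 : ℕ)

local infixr:60 " ;; " => Program.seq

attribute [local simp] Program.run IntExp.eval RealExp.eval Store.setInt_int_self
  Store.setInt_int_of_ne Store.setInt_real Store.setReal_int Store.setReal_real_self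
  Store.setReal_real_of_ne

namespace CoverTask

/-- The initial memory for the task `B`, the number of whose colours is restricted to the number of
disks. -/
structure InputOf (B : CoverTask) (s : Store) : Prop where
  n : s.int aInput 0 = B.n
  m : s.int aInput 1 = B.m
  K : min (s.int aInput 2) B.m = B.K
  zero : ∀ a ≠ aInput, ∀ i, s.int a i = 0
  px : s.real aPointX = B.px
  py : s.real aPointY = B.py
  dx : s.real aDiskX = B.dx
  dy : s.real aDiskY = B.dy

/-- The memory holds the data of the task, with tables for the disks, the colours and the powers
`2 ^ e` of the items, because the machine cannot multiply natural numbers. -/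
structure HeldBy (B : CoverTask) (s : Store) : Prop where
  n : s.int aInput 0 = B.n
  numItems : s.int vNumItems 0 = B.numItems
  K : s.int vK 0 = B.K
  disk : ∀ e < B.numItems, s.int aDisk e = e % B.m
  color : ∀ e < B.numItems, s.int aColor e = e / B.m
  pow : ∀ e < B.numItems, s.int aPow e = 2 ^ e
  px : s.real aPointX = B.px
  py : s.real aPointY = B.py
  dx : s.real aDiskX = B.dx
  dy : s.real aDiskY = B.dy

theorem HeldBy.of_agreeOff {B : CoverTask} {p : Program} {s s' : Store} (h : B.HeldBy s)
    (hs : AgreeOff p s s')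
    (hp : p.keeps [aInput, vNumItems, vK, aDisk, aColor, aPow] [aPointX, aPointY, aDiskX, aDiskY]
      = true := by rfl) : B.HeldBy s' := by
  have hkeep := hs.of_keeps hp
  simp only [List.forall_mem_cons] at hkeep
  obtain ⟨⟨hn, hM, hK, hd, hc, hw, -⟩, hpx, hpy, hdx, hdy, -⟩ := hkeep
  exact ⟨hn ▸ h.n, hM ▸ h.numItems, hK ▸ h.K, hd ▸ h.disk, hc ▸ h.color, hw ▸ h.pow,
    hpx ▸ h.px, hpy ▸ h.py, hdx ▸ h.dx, hdy ▸ h.dy⟩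

end CoverTask

/-- The memory holds the data of the task of a strip. -/
structure StripTask.HeldBy (S : StripTask) (s : Store) : Prop extends S.toCoverTask.HeldBy s where
  base : s.real vBase 0 = S.y₀

theorem StripTask.HeldBy.of_agreeOff {S : StripTask} {p : Program} {s s' : Store}
    (h : S.HeldBy s) (hs : AgreeOff p s s')
    (hp : p.keeps [aInput, vNumItems, vK, aDisk, aColor, aPow] [aPointX, aPointY, aDiskX, aDiskY]
      = true := by rfl) (hbase : p.writesReal vBase = false := by rfl) : S.HeldBy s' :=
  ⟨h.toHeldBy.of_agreeOff hs hp, by rw [hs.real vBase hbase, h.base]⟩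

namespace CoverProgram

/-! ### Tests -/

abbrev positive (e : IntExp) : Test := .intLe (.const 1) e

abbrev or (b c : Test) : Test := .not (.and (.not b) (.not c))

abbrev sq (e : RealExp) : RealExp := .mul e e

abbrev itemX (v : ℕ) : RealExp := .get aDiskX (.get aDisk (.var v))

abbrev itemY (v : ℕ) : RealExp := .get aDiskY (.get aDisk (.var v))

abbrev pointX : RealExp := .get aPointX (.var vP)

abbrev pointY : RealExp := .get aPointY (.var vP)

abbrev base : RealExp := .get vBase (.const 0)

abbrev inHead : Test := positive (.get aSet (.add (.var vHeadSet) (.var vE)))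

abbrev coveredByHead : Test := positive (.get aFlag (.add (.var vHeadFlag) (.var vP)))

/-- The item `vE` is not to the right of the item `vF` and not in conflict with it. -/
def precedesTest : Test :=
  .and (.realLe (itemX vE) (itemX vF)) (.not (.and (.and
      (.intLe (.get aColor (.var vE)) (.get aColor (.var vF)))
      (.intLe (.get aColor (.var vF)) (.get aColor (.var vE))))
    (.realLe (.add (sq (.sub (itemX vE) (itemX vF))) (sq (.sub (itemY vE) (itemY vF))))
      (.const 4))))

/-- The item `vE` is not too far to the left for the window of the item `vF`. -/
def windowTest : Test := .realLe (.sub (itemX vF) (.const 2)) (itemX vE)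

/-- The disk of the item `vF` contains the point `vP`. -/
def coversTest : Test :=
  .realLe (.add (sq (.sub pointX (itemX vF))) (sq (.sub pointY (itemY vF)))) (.const 1)

/-- The point `vP` may still be covered by items to the right of the item `vF`. -/
def laterTest : Test := .realLe (.sub (itemX vF) (.const 1)) pointX

/-- The centre of the item `vF` is at distance at most `1` from the strip. -/
def relevantTest : Test :=
  .and (.realLe (.sub base (.const 1)) (itemY vF))
    (.realLe (itemY vF) (.add base (.const (12 / 5))))

/-- The point `vP` lies in the strip. -/
def needsTest : Test :=
  .and (.realLe base pointY) (.not (.realLe (.add base (.const (7 / 5))) pointY))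

theorem holds_positive {e : IntExp} {s : Store} : (positive e).Holds s ↔ 0 < e.eval s := Iff.rfl

theorem holds_or {b c : Test} {s : Store} : (or b c).Holds s ↔ b.Holds s ∨ c.Holds s := by
  simp only [Test.Holds, not_and_or, not_not]

section Holds

variable {S : StripTask} {s : Store}

theorem holds_precedesTest (hS : S.HeldBy s) (he : s.int vE 0 < S.numItems)
    (hf : s.int vF 0 < S.numItems) :
    precedesTest.Holds s ↔ S.x (s.int vE 0) ≤ S.x (s.int vF 0) ∧
      ¬ S.Conflict (s.int vE 0) (s.int vF 0) := by
  simp [precedesTest, Test.Holds, CoverTask.Conflict, CoverTask.x, CoverTask.y, hS.disk _ he,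
    hS.disk _ hf, hS.color _ he, hS.color _ hf, hS.dx, hS.dy, le_antisymm_iff]

theorem holds_windowTest (hS : S.HeldBy s) (he : s.int vE 0 < S.numItems)
    (hf : s.int vF 0 < S.numItems) :
    windowTest.Holds s ↔ S.x (s.int vF 0) - 2 ≤ S.x (s.int vE 0) := by
  simp [windowTest, Test.Holds, CoverTask.x, hS.disk _ he, hS.disk _ hf, hS.dx]

theorem holds_coversTest (hS : S.HeldBy s) (hf : s.int vF 0 < S.numItems) :
    coversTest.Holds s ↔ S.Covers (s.int vF 0) (s.int vP 0) := by
  simp [coversTest, Test.Holds, CoverTask.Covers, CoverTask.x, CoverTask.y, hS.disk _ hf, hS.dx,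
    hS.dy, hS.px, hS.py]

theorem holds_laterTest (hS : S.HeldBy s) (hf : s.int vF 0 < S.numItems) :
    laterTest.Holds s ↔ S.x (s.int vF 0) - 1 ≤ S.px (s.int vP 0) := by
  simp [laterTest, Test.Holds, CoverTask.x, hS.disk _ hf, hS.dx, hS.px]

theorem holds_relevantTest (hS : S.HeldBy s) (hf : s.int vF 0 < S.numItems) :
    relevantTest.Holds s ↔ S.Relevant (s.int vF 0) := by
  simp [relevantTest, Test.Holds, StripTask.Relevant, CoverTask.y, hS.disk _ hf, hS.dy, hS.base]

theorem holds_needsTest (hS : S.HeldBy s) : needsTest.Holds s ↔ S.Needs (s.int vP 0) := by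
  simp [needsTest, Test.Holds, StripTask.Needs, hS.py, hS.base]

end Holds

/-! ### Loops over the items and the points -/

/-- Sets `vOk` to `0` if the test fails for some value of `v` less than `w`. -/
def checkAll (v w : ℕ) (c : Test) : Program :=
  .forLoop v (.var w) (.ifElse c .skip (.setVar vOk (.const 0)))

/-- Writes the truth values of the test, for the values of `v` less than `w`, into a block of the
array `a` at the offset `t`. -/
def writeBlock (v w a t : ℕ) (c : Test) : Program :=
  .forLoop v (.var w) (.ifElse c (.setInt a (.add (.var t) (.var v)) (.const 1))
    (.setInt a (.add (.var t) (.var v)) (.const 0)))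

section Loops

variable {v w a t : ℕ} {c : Test} {s : Store} {N T : ℕ} {P : ℕ → Prop}

theorem checkAll_runs (hN : s.int w 0 = N) (hw : (checkAll v w c).writesInt w = false)
    (hv : v ≠ vOk)
    (hc : ∀ i < N, ∀ s', AgreeOff (checkAll v w c) s s' → s'.int v 0 = i → (c.Holds s' ↔ P i))
    (hT : c.cost + 20 ≤ T) :
    Runs (checkAll v w c) s (T * (N + 1)) fun s' =>
      0 < s'.int vOk 0 ↔ 0 < s.int vOk 0 ∧ ∀ i < N, P i := by
  refine (Runs.forLoop N (c.cost + 4)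
    (fun j s' => 0 < s'.int vOk 0 ↔ 0 < s.int vOk 0 ∧ ∀ i < j, P i)
    (fun s' hs' => by rw [IntExp.eval, hs'.int w hw]; exact hN) ?_ ?_ ?_).mono ?_ fun _ _ h => h
  · simpa [Program.writesInt] using hv.symm
  · simp [hv.symm]
  · intro j s' hj hs' hvj hI
    have hcj := hc j hj s' hs' hvj
    refine Runs.ifElse (fun hh => ?_) fun hh => ?_
    · refine .of_loopFree rfl (by decide) ?_
      rw [Nat.forall_lt_succ_right]
      simp [hv.symm, hI, hcj.1 hh]
    · refine .of_loopFree rfl (by decide) ?_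
      rw [Nat.forall_lt_succ_right]
      simp [hv.symm, mt hcj.2 hh]
  · simp only [IntExp.cost]
    nlinarith

theorem writeBlock_runs {t₀ : ℕ} (hN : s.int w 0 = N) (ht : s.int t 0 = t₀)
    (hw : (writeBlock v w a t c).writesInt w = false)
    (htw : (writeBlock v w a t c).writesInt t = false) (hv : v ≠ a)
    (hc : ∀ i < N, ∀ s', AgreeOff (writeBlock v w a t c) s s' → s'.int v 0 = i →
      (∀ j < t₀, s'.int a j = s.int a j) → (c.Holds s' ↔ P i))
    (hT : c.cost + 24 ≤ T) :
    Runs (writeBlock v w a t c) s (T * (N + 1)) fun s' =>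
      (∀ i < N, 0 < s'.int a (t₀ + i) ↔ P i) ∧ ∀ j < t₀, s'.int a j = s.int a j := by
  refine (Runs.forLoop N (c.cost + 8)
    (fun j s' => (∀ i < j, 0 < s'.int a (t₀ + i) ↔ P i) ∧ ∀ j < t₀, s'.int a j = s.int a j)
    (fun s' hs' => by rw [IntExp.eval, hs'.int w hw]; exact hN) ?_ ?_ ?_).mono ?_ fun _ _ h => h
  · simpa [Program.writesInt] using hv.symm
  · simp [hv.symm]
  · intro j s' hj hs' hvj hI
    have hcj := hc j hj s' hs' hvj hI.2
    have ht' : s'.int t 0 = t₀ := by rw [hs'.int t htw, ht]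
    have hstep (b : ℕ) (hb : 0 < b ↔ P j) :
        (∀ i < j + 1, 0 < Function.update (s'.int a) (t₀ + j) b (t₀ + i) ↔ P i) ∧
          ∀ i < t₀, Function.update (s'.int a) (t₀ + j) b i = s.int a i := by
      refine ⟨Nat.forall_lt_succ_right.2 ⟨fun i hi => ?_, ?_⟩, fun i hi => ?_⟩
      · rw [Function.update_of_ne (by lia), hI.1 i hi]
      · rw [Function.update_self, hb]
      · rw [Function.update_of_ne (by lia), hI.2 i hi]
    refine Runs.ifElse (fun hh => ?_) fun hh => ?_
    · refine .of_loopFree rfl (by simp [Program.maxCost, IntExp.cost]) ?_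
      simpa [hv.symm, ht', hvj] using hstep 1 (by simp [hcj.1 hh])
    · refine .of_loopFree rfl (by simp [Program.maxCost, IntExp.cost]) ?_
      simpa [hv.symm, ht', hvj] using hstep 0 (by simp [mt hcj.2 hh])
  · simp only [IntExp.cost]
    nlinarith

end Loops

end CoverProgram

attribute [local simp] CoverProgram.holds_positive

open CoverProgram

/-! ### Extending a set by an item -/

/-- The first queue is an initial segment of the second one. -/
structure SearchQueue.IsPrefix (Q Q' : SearchQueue) : Prop where
  size_le : Q.size ≤ Q'.size
  set_eq : ∀ q < Q.size, Q'.set q = Q.set q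
  last_eq : ∀ q < Q.size, Q'.last q = Q.last q

namespace SearchQueue.IsPrefix

variable {Q Q' Q'' : SearchQueue}

theorem refl (Q : SearchQueue) : Q.IsPrefix Q := ⟨le_rfl, fun _ _ => rfl, fun _ _ => rfl⟩

theorem trans (h : Q.IsPrefix Q') (h' : Q'.IsPrefix Q'') : Q.IsPrefix Q'' where
  size_le := h.size_le.trans h'.size_le
  set_eq q hq := (h'.set_eq q (hq.trans_le h.size_le)).trans (h.set_eq q hq)
  last_eq q hq := (h'.last_eq q (hq.trans_le h.size_le)).trans (h.last_eq q hq)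

theorem push (Q : SearchQueue) (q f : ℕ) : Q.IsPrefix (Q.push q f) :=
  ⟨Nat.le_succ _, fun _ hr => Q.push_set_of_lt q f hr, fun _ hr => Q.push_last_of_lt q f hr⟩

end SearchQueue.IsPrefix

theorem SearchQueue.forall_lt_push (Q : SearchQueue) {q f : ℕ} {P : ℕ → Finset ℕ → Prop} :
    (∀ r < (Q.push q f).size, P r ((Q.push q f).set r)) ↔
      (∀ r < Q.size, P r (Q.set r)) ∧ P Q.size (insert f (Q.set q)) := by
  rw [push, Nat.forall_lt_succ_right, ← push, push_set_size]
  exact and_congr_left fun _ => forall₂_congr fun r hr => by rw [Q.push_set_of_lt q f hr]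

namespace StripTask

variable {S : StripTask} {A : Finset ℕ} {f : ℕ}

theorem Represented.mono {Q Q' : SearchQueue} (h : S.Represented Q A f) (hQ : Q.IsPrefix Q') :
    S.Represented Q' A f := by
  obtain ⟨q, hq, hq0, hw⟩ := h
  exact ⟨q, hq.trans_le hQ.size_le, hq0, by rw [hQ.set_eq q hq, hQ.last_eq q hq, hw]⟩

theorem coveredBy_insert {p : ℕ} :
    S.CoveredBy (insert f A) p ↔ S.CoveredBy A p ∨ S.Covers f p := by
  by_cases hneed : S.Needs p <;> simp [CoveredBy, hneed, or_comm]

theorem extends_iff (hA : ∀ e ∈ A, e < S.numItems) :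
    S.Extends A f ↔ S.Relevant f ∧
      (∀ e < S.numItems, e ∈ A → S.x e ≤ S.x f ∧ ¬ S.Conflict e f) ∧
      ∀ p < S.n, S.CoveredBy A p ∨ S.x f - 1 ≤ S.px p := by
  constructor
  · intro h
    refine ⟨h.relevant, fun e _ he => ⟨h.le e he, h.not_conflict e he⟩, fun p hp => ?_⟩
    exact (lt_or_ge (S.px p) (S.x f - 1)).imp_left (h.covered p hp)
  · rintro ⟨hrel, hitems, hpoints⟩
    exact ⟨hrel, fun e he => (hitems e (hA e he) he).1, fun e he => (hitems e (hA e he) he).2,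
      fun p hp hlt => (hpoints p hp).resolve_right hlt.not_ge⟩

/-- The address of a window in the table of the visited windows. -/
noncomputable def key (S : StripTask) (A : Finset ℕ) (f : ℕ) : ℕ := ∑ e ∈ S.window A f, 2 ^ e

theorem key_eq_iff {A B : Finset ℕ} {f g : ℕ} :
    S.key A f = S.key B g ↔ S.window A f = S.window B g :=
  (Finset.geomSum_injective le_rfl).eq_iff

theorem key_insert (hf : f ∉ A) : S.key (insert f A) f = 2 ^ f + S.key A f := by
  classical
  have hself : S.x f - 2 ≤ S.x f := by linarith
  rw [key, key, window, Finset.filter_insert, if_pos hself, Finset.sum_insert (by simp [hf]),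
    window]

/-- A nonempty set in the queue has a window with the key `κ`. -/
def Visited (S : StripTask) (Q : SearchQueue) (κ : ℕ) : Prop :=
  ∃ q < Q.size, q ≠ 0 ∧ S.key (Q.set q) (Q.last q) = κ

theorem visited_key_iff {Q : SearchQueue} :
    S.Visited Q (S.key (insert f A) f) ↔ S.Represented Q A f := by
  simp only [Visited, Represented, key_eq_iff]

theorem visited_push {Q : SearchQueue} (hQ : Q.size ≠ 0) {h κ : ℕ} :
    S.Visited (Q.push h f) κ ↔ S.Visited Q κ ∨ S.key (insert f (Q.set h)) f = κ := by
  constructor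
  · rintro ⟨q, hq, hq0, hκ⟩
    rcases Nat.lt_succ_iff_lt_or_eq.1 hq with hq | rfl
    · rw [Q.push_set_of_lt h f hq, Q.push_last_of_lt h f hq] at hκ
      exact .inl ⟨q, hq, hq0, hκ⟩
    · rw [Q.push_set_size, Q.push_last_size] at hκ
      exact .inr hκ
  · rintro (⟨q, hq, hq0, hκ⟩ | hκ)
    · refine ⟨q, hq.trans (Nat.lt_succ_self _), hq0, ?_⟩
      rw [Q.push_set_of_lt h f hq, Q.push_last_of_lt h f hq, hκ]
    · exact ⟨Q.size, Nat.lt_succ_self _, hQ, by rw [Q.push_set_size, Q.push_last_size, hκ]⟩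

/-- The memory holds the queue and the table of the visited windows, and the set number `h` is at
the head. A window is visited if the table holds the number `c` of the strip at its address, so that
the table need not be cleared for the next strip. -/
structure SearchState (S : StripTask) (c : ℕ) (Q : SearchQueue) (h : ℕ) (s : Store) : Prop
    extends held : S.HeldBy s where
  valid : S.Valid Q
  head : s.int vHead 0 = h
  headSet : s.int vHeadSet 0 = h * S.numItems
  headFlag : s.int vHeadFlag 0 = h * S.n
  tail : s.int vTail 0 = Q.size
  tailSet : s.int vTailSet 0 = Q.size * S.numItems
  tailFlag : s.int vTailFlag 0 = Q.size * S.n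
  set : ∀ q < Q.size, ∀ e < S.numItems, 0 < s.int aSet (q * S.numItems + e) ↔ e ∈ Q.set q
  flag : ∀ q < Q.size, ∀ p < S.n, 0 < s.int aFlag (q * S.n + p) ↔ S.CoveredBy (Q.set q) p
  stamp : s.int vStamp 0 = c
  visited_le : ∀ κ, s.int aVisited κ ≤ c
  visited_eq : ∀ κ, s.int aVisited κ = c ↔ S.Visited Q κ

namespace SearchState

variable {c h : ℕ} {Q : SearchQueue} {p : Program} {s s' : Store}

theorem of_agree_below (hs : S.SearchState c Q h s) (hss : AgreeOff p s s')
    (hset : ∀ i < Q.size * S.numItems, s'.int aSet i = s.int aSet i)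
    (hflag : ∀ i < Q.size * S.n, s'.int aFlag i = s.int aFlag i)
    (hp : p.keeps [aInput, vNumItems, vK, aDisk, aColor, aPow] [aPointX, aPointY, aDiskX, aDiskY]
      = true := by rfl) (hbase : p.writesReal vBase = false := by rfl)
    (hvars : p.keeps [vHead, vHeadSet, vHeadFlag, vTail, vTailSet, vTailFlag, vStamp, aVisited] []
      = true := by rfl) : S.SearchState c Q h s' := by
  have hkeep := (hss.of_keeps hvars).1
  simp only [List.forall_mem_cons] at hkeep
  obtain ⟨h₁, h₂, h₃, h₄, h₅, h₆, h₇, h₈, -⟩ := hkeep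
  have hlt {q r N : ℕ} (hq : q < Q.size) (hr : r < N) : q * N + r < Q.size * N := by
    nlinarith
  exact ⟨hs.held.of_agreeOff hss hp hbase, hs.valid, h₁ ▸ hs.head, h₂ ▸ hs.headSet,
    h₃ ▸ hs.headFlag, h₄ ▸ hs.tail, h₅ ▸ hs.tailSet, h₆ ▸ hs.tailFlag,
    fun q hq e he => by rw [hset _ (hlt hq he), hs.set q hq e he],
    fun q hq p hp => by rw [hflag _ (hlt hq hp), hs.flag q hq p hp],
    h₇ ▸ hs.stamp, h₈ ▸ hs.visited_le, h₈ ▸ hs.visited_eq⟩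

theorem of_agreeOff (hs : S.SearchState c Q h s) (hss : AgreeOff p s s')
    (hp : p.keeps [aInput, vNumItems, vK, aDisk, aColor, aPow] [aPointX, aPointY, aDiskX, aDiskY]
      = true := by rfl) (hbase : p.writesReal vBase = false := by rfl)
    (hvars : p.keeps [vHead, vHeadSet, vHeadFlag, vTail, vTailSet, vTailFlag, vStamp, aVisited] []
      = true := by rfl) (hset : p.writesInt aSet = false := by rfl)
    (hflag : p.writesInt aFlag = false := by rfl) : S.SearchState c Q h s' :=
  hs.of_agree_below hss (fun _ _ => congrFun (hss.int _ hset) _)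
    (fun _ _ => congrFun (hss.int _ hflag) _) hp hbase hvars

theorem holds_inHead (hs : S.SearchState c Q h s) (hh : h < Q.size)
    (he : s.int vE 0 < S.numItems) : inHead.Holds s ↔ s.int vE 0 ∈ Q.set h := by
  simp [holds_positive, hs.headSet, hs.set h hh _ he]

theorem holds_coveredByHead (hs : S.SearchState c Q h s) (hh : h < Q.size)
    (hp : s.int vP 0 < S.n) : coveredByHead.Holds s ↔ S.CoveredBy (Q.set h) (s.int vP 0) := by
  simp [holds_positive, hs.headFlag, hs.flag h hh _ hp]

theorem represented_iff (hs : S.SearchState c Q h s) :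
    S.Represented Q A f ↔ c ≤ s.int aVisited (S.key (insert f A) f) := by
  rw [← visited_key_iff, ← hs.visited_eq, (hs.visited_le _).ge_iff_eq]

end SearchState

end StripTask

namespace CoverProgram

open StripTask

/-- Decides whether the item `vF` extends the set at the head. -/
def checkItem : Program :=
  .ifElse relevantTest (.setVar vOk (.const 1)) (.setVar vOk (.const 0)) ;;
  checkAll vE vNumItems (or (.not inHead) precedesTest) ;;
  checkAll vP aInput (or coveredByHead laterTest)

/-- Computes the key of the extension of the set at the head by the item `vF`. -/
def computeKey : Program :=
  .setVar vKey (.get aPow (.var vF)) ;;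
  .forLoop vE (.var vNumItems) (.ifElse (.and inHead windowTest)
    (.setVar vKey (.add (.var vKey) (.get aPow (.var vE)))) .skip)

def advanceTail : Program :=
  .setVar vTail (.add (.var vTail) (.const 1)) ;;
  .setVar vTailSet (.add (.var vTailSet) (.var vNumItems)) ;;
  .setVar vTailFlag (.add (.var vTailFlag) (.var aInput))

/-- Appends the extension of the set at the head by the item `vF` to the queue. -/
def enqueue : Program :=
  writeBlock vE vNumItems aSet vTailSet
    (or inHead (.and (.intLe (.var vE) (.var vF)) (.intLe (.var vF) (.var vE)))) ;;
  writeBlock vP aInput aFlag vTailFlag (or coveredByHead coversTest) ;;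
  .setInt aVisited (.var vKey) (.var vStamp) ;;
  advanceTail

/-- Enqueues the extension of the set at the head by the item `vF` if it is admissible and its
window is new. -/
def tryItem : Program :=
  checkItem ;; computeKey ;;
  .ifElse (.and (positive (.var vOk)) (.not (.intLe (.var vStamp) (.get aVisited (.var vKey)))))
    enqueue .skip

variable {S : StripTask} {c h f : ℕ} {Q : SearchQueue} {s : Store}

theorem checkItem_runs (hs : S.SearchState c Q h s) (hh : h < Q.size) (hf : s.int vF 0 = f)
    (hfM : f < S.numItems) :
    Runs checkItem s (300 * (S.numItems + S.n + 1)) fun s' =>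
      0 < s'.int vOk 0 ↔ S.Extends (Q.set h) f := by
  have hrel : Runs (.ifElse relevantTest (.setVar vOk (.const 1)) (.setVar vOk (.const 0))) s 50
      fun s' => 0 < s'.int vOk 0 ↔ S.Relevant f := by
    have htest := holds_relevantTest hs.held (hf ▸ hfM)
    rw [hf] at htest
    refine .of_loopFree rfl (by decide) ?_
    by_cases hrel : S.Relevant f <;> simp [htest, hrel]
  have hitems (s₁ : Store) (h₁ : AgreeOff checkItem s s₁) :
      Runs (checkAll vE vNumItems (or (.not inHead) precedesTest)) s₁ (150 * (S.numItems + 1))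
        fun s' => 0 < s'.int vOk 0 ↔ 0 < s₁.int vOk 0 ∧
          ∀ e < S.numItems, e ∈ Q.set h → S.x e ≤ S.x f ∧ ¬ S.Conflict e f := by
    have hs₁ := hs.of_agreeOff h₁
    refine checkAll_runs hs₁.numItems rfl (by decide) (fun e he s₂ h₂ hve => ?_) (by decide)
    have hs₂ := hs₁.of_agreeOff h₂
    have hf₂ : s₂.int vF 0 = f := by rw [h₂.int vF rfl, h₁.int vF rfl, hf]
    rw [holds_or, Test.Holds, hs₂.holds_inHead hh (hve ▸ he),
      holds_precedesTest hs₂.held (hve ▸ he) (hf₂ ▸ hfM), hve, hf₂, imp_iff_not_or]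
  have hpoints (s₁ : Store) (h₁ : AgreeOff checkItem s s₁) :
      Runs (checkAll vP aInput (or coveredByHead laterTest)) s₁ (100 * (S.n + 1))
        fun s' => 0 < s'.int vOk 0 ↔ 0 < s₁.int vOk 0 ∧
          ∀ p < S.n, S.CoveredBy (Q.set h) p ∨ S.x f - 1 ≤ S.px p := by
    have hs₁ := hs.of_agreeOff h₁
    refine checkAll_runs hs₁.n rfl (by decide) (fun p hp s₂ h₂ hvp => ?_) (by decide)
    have hs₂ := hs₁.of_agreeOff h₂
    have hf₂ : s₂.int vF 0 = f := by rw [h₂.int vF rfl, h₁.int vF rfl, hf]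
    rw [holds_or, hs₂.holds_coveredByHead hh (hvp ▸ hp), holds_laterTest hs₂.held (hf₂ ▸ hfM),
      hvp, hf₂]
  refine (hrel.seq fun s₁ h₁ hrel₁ => (hitems s₁ h₁.seq_left).seq fun s₂ h₂ hitems₂ =>
    (hpoints s₂ (h₁.seq h₂.seq_left)).mono le_rfl fun s₃ _ hpoints₃ => ?_).mono (by lia)
      fun _ _ h => h
  rw [hpoints₃, hitems₂, hrel₁, extends_iff (hs.valid.independent hh).lt, and_assoc]

theorem computeKey_runs (hs : S.SearchState c Q h s) (hh : h < Q.size) (hf : s.int vF 0 = f)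
    (hfM : f < S.numItems) :
    Runs computeKey s (100 * (S.numItems + 1)) fun s' =>
      s'.int vKey 0 = 2 ^ f + S.key (Q.set h) f := by
  classical
  have hinit : Runs (.setVar vKey (.get aPow (.var vF))) s 10 fun s' => s'.int vKey 0 = 2 ^ f :=
    .of_loopFree rfl (by decide) (by simp [hf, hs.held.pow f hfM])
  have hkey : Finset.range S.numItems ∩ S.window (Q.set h) f = S.window (Q.set h) f := by
    refine Finset.inter_eq_right.2 fun e he => Finset.mem_range.2 ?_
    exact (hs.valid.independent hh).lt e (mem_window.1 he).1
  refine (hinit.seq fun s₁ h₁ hkey₁ => Runs.forLoop S.numItems 70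
    (fun j s' => s'.int vKey 0 = 2 ^ f + ∑ e ∈ Finset.range j ∩ S.window (Q.set h) f, 2 ^ e)
    (b := .var vNumItems) (fun s' h₂ => (hs.of_agreeOff (h₁.seq h₂)).held.numItems) rfl
    (by simp [hkey₁]) fun e s₂ he h₂ hve hkey₂ => ?_).mono (by simp only [IntExp.cost]; lia)
      fun s' _ h => by rwa [hkey] at h
  have h₁₂ : AgreeOff computeKey s s₂ := h₁.seq h₂
  have hs₂ := hs.of_agreeOff h₁₂
  have hf₂ : s₂.int vF 0 = f := by rw [h₁₂.int vF rfl, hf]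
  have htest : (inHead.and windowTest).Holds s₂ ↔ e ∈ S.window (Q.set h) f := by
    rw [Test.Holds, hs₂.holds_inHead hh (hve ▸ he),
      holds_windowTest hs₂.held (hve ▸ he) (hf₂ ▸ hfM), hve, hf₂, mem_window]
  refine .of_loopFree rfl (by decide) ?_
  by_cases hmem : e ∈ S.window (Q.set h) f <;>
    simp [htest, hmem, hve, hkey₂, hs₂.held.pow e he, Finset.range_add_one, add_assoc,
      add_comm (2 ^ e)]

theorem publish_runs (hs : S.SearchState c Q h s) (hh : h < Q.size) (hf : f < S.numItems)
    (hext : S.Extends (Q.set h) f) (hnew : ¬ S.Represented Q (Q.set h) f)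
    (hkey : s.int vKey 0 = S.key (insert f (Q.set h)) f)
    (hset : ∀ e < S.numItems, 0 < s.int aSet (Q.size * S.numItems + e) ↔ e ∈ insert f (Q.set h))
    (hflag : ∀ p < S.n, 0 < s.int aFlag (Q.size * S.n + p) ↔
      S.CoveredBy (insert f (Q.set h)) p) :
    Runs (.setInt aVisited (.var vKey) (.var vStamp) ;; advanceTail) s 40
      (S.SearchState c (Q.push h f) h) := by
  refine .of_loopFree rfl (by decide) ?_
  have hkeep : AgreeOff (.setInt aVisited (.var vKey) (.var vStamp) ;; advanceTail) s _ :=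
    .run rfl
  have hvisited : ((Program.setInt aVisited (.var vKey) (.var vStamp) ;; advanceTail).run s).int
      aVisited = Function.update (s.int aVisited) (S.key (insert f (Q.set h)) f) c := by
    simp [advanceTail, hkey, hs.stamp]
  exact
    { held := hs.held.of_agreeOff hkeep
      valid := hs.valid.push hh hf hext hnew
      head := by simp [advanceTail, hs.head]
      headSet := by simp [advanceTail, hs.headSet]
      headFlag := by simp [advanceTail, hs.headFlag]
      tail := by simp [advanceTail, hs.tail, SearchQueue.push]
      tailSet := by simp [advanceTail, hs.tailSet, hs.held.numItems, SearchQueue.push, add_mul]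
      tailFlag := by simp [advanceTail, hs.tailFlag, hs.held.n, SearchQueue.push, add_mul]
      set := by
        rw [hkeep.int aSet rfl]
        exact (Q.forall_lt_push (P := fun q A => ∀ e < S.numItems,
          0 < s.int aSet (q * S.numItems + e) ↔ e ∈ A)).2 ⟨hs.set, hset⟩
      flag := by
        rw [hkeep.int aFlag rfl]
        exact (Q.forall_lt_push (P := fun q A => ∀ p < S.n,
          0 < s.int aFlag (q * S.n + p) ↔ S.CoveredBy A p)).2 ⟨hs.flag, hflag⟩
      stamp := by simp [advanceTail, hs.stamp]
      visited_le κ := by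
        rw [hvisited, Function.update_apply]
        exact ite_le_sup .. |>.trans (sup_le le_rfl (hs.visited_le κ))
      visited_eq κ := by
        rw [hvisited, Function.update_apply, visited_push hs.valid.pos.ne', ← hs.visited_eq]
        grind }

theorem enqueue_runs (hs : S.SearchState c Q h s) (hh : h < Q.size) (hf : s.int vF 0 = f)
    (hfM : f < S.numItems) (hext : S.Extends (Q.set h) f)
    (hnew : ¬ S.Represented Q (Q.set h) f)
    (hkey : s.int vKey 0 = S.key (insert f (Q.set h)) f) :
    Runs enqueue s (200 * (S.numItems + S.n + 1)) (S.SearchState c (Q.push h f) h) := by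
  have hitems : Runs (writeBlock vE vNumItems aSet vTailSet
      (or inHead (.and (.intLe (.var vE) (.var vF)) (.intLe (.var vF) (.var vE))))) s
      (100 * (S.numItems + 1)) fun s' => S.SearchState c Q h s' ∧
        ∀ e < S.numItems, 0 < s'.int aSet (Q.size * S.numItems + e) ↔ e ∈ insert f (Q.set h) := by
    refine (writeBlock_runs hs.held.numItems hs.tailSet rfl rfl (by decide)
      (fun e he s₁ h₁ hve hlow => ?_) (by decide)).mono le_rfl fun s' h' hpost =>
        ⟨hs.of_agree_below h' hpost.2 fun _ _ => congrFun (h'.int _ rfl) _, hpost.1⟩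
    have hs₁ := hs.of_agree_below h₁ hlow fun _ _ => congrFun (h₁.int _ rfl) _
    have hf₁ : s₁.int vF 0 = f := by rw [h₁.int vF rfl, hf]
    rw [holds_or, hs₁.holds_inHead hh (hve ▸ he), Finset.mem_insert, or_comm]
    simp [Test.Holds, hve, hf₁, le_antisymm_iff]
  have hpoints (s₁ : Store) (hs₁ : S.SearchState c Q h s₁) (hf₁ : s₁.int vF 0 = f) :
      Runs (writeBlock vP aInput aFlag vTailFlag (or coveredByHead coversTest)) s₁
      (100 * (S.n + 1)) fun s' => S.SearchState c Q h s' ∧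
        ∀ p < S.n, 0 < s'.int aFlag (Q.size * S.n + p) ↔ S.CoveredBy (insert f (Q.set h)) p := by
    refine (writeBlock_runs hs₁.held.n hs₁.tailFlag rfl rfl (by decide)
      (fun p hp s₂ h₂ hvp hlow => ?_) (by decide)).mono le_rfl fun s' h' hpost =>
        ⟨hs₁.of_agree_below h' (fun _ _ => congrFun (h'.int _ rfl) _) hpost.2, hpost.1⟩
    have hs₂ := hs₁.of_agree_below h₂ (fun _ _ => congrFun (h₂.int _ rfl) _) hlow
    have hf₂ : s₂.int vF 0 = f := by rw [h₂.int vF rfl, hf₁]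
    rw [holds_or, hs₂.holds_coveredByHead hh (hvp ▸ hp), holds_coversTest hs₂.held (hf₂ ▸ hfM),
      hvp, hf₂, coveredBy_insert]
  refine (hitems.seq fun s₁ h₁ hs₁ => (hpoints s₁ hs₁.1 (by rw [h₁.int vF rfl, hf])).seq
    fun s₂ h₂ hs₂ => publish_runs hs₂.1 hh hfM hext hnew ?_ ?_ hs₂.2).mono (by lia)
      fun _ _ h => h
  · rw [h₂.int vKey rfl, h₁.int vKey rfl, hkey]
  · rw [h₂.int aSet rfl]
    exact hs₁.2

theorem tryItem_runs (hs : S.SearchState c Q h s) (hh : h < Q.size) (hf : s.int vF 0 = f)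
    (hfM : f < S.numItems) :
    Runs tryItem s (700 * (S.numItems + S.n + 1)) fun s' => ∃ Q', S.SearchState c Q' h s' ∧
      Q.IsPrefix Q' ∧ (S.Extends (Q.set h) f → S.Represented Q' (Q.set h) f) := by
  refine ((checkItem_runs hs hh hf hfM).seq (T' := 400 * (S.numItems + S.n + 1))
    fun s₁ h₁ hok₁ => ?_).mono (by lia) fun _ _ h => h
  have hf₁ : s₁.int vF 0 = f := by rw [h₁.int vF rfl, hf]
  have hs₁ := hs.of_agreeOff h₁
  refine ((computeKey_runs hs₁ hh hf₁ hfM).seq (T' := 300 * (S.numItems + S.n + 1))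
    fun s₂ h₂ hkey₂ => ?_).mono (by lia) fun _ _ h => h
  have hs₂ := hs₁.of_agreeOff h₂
  have htest : (Test.and (positive (.var vOk))
      (.not (.intLe (.var vStamp) (.get aVisited (.var vKey))))).Holds s₂ ↔
      S.Extends (Q.set h) f ∧ ¬ S.Represented Q (Q.set h) f := by
    rw [Test.Holds, holds_positive, IntExp.eval, IntExp.eval, h₂.int vOk rfl, hok₁]
    refine and_congr_right fun hext => not_congr ?_
    simp [Test.Holds, hs₂.represented_iff, key_insert hext.notMem, hs₂.stamp, hkey₂]
  refine (Runs.ifElse (T := 200 * (S.numItems + S.n + 1)) (fun hb => ?_) fun hb => ?_).mono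
    (by simp only [Test.cost, IntExp.cost]; lia) fun _ _ h => h
  · obtain ⟨hext, hnew⟩ := htest.1 hb
    have hf₂ : s₂.int vF 0 = f := by rw [h₂.int vF rfl, hf₁]
    refine (enqueue_runs hs₂ hh hf₂ hfM hext hnew ?_).mono le_rfl fun s' _ hs' =>
      ⟨_, hs', .push Q h f, fun _ => represented_push Q hs.valid.pos.ne' h f⟩
    rw [hkey₂, key_insert hext.notMem]
  · refine .of_loopFree rfl (by simp only [Program.maxCost]; lia) ⟨Q, hs₂, .refl Q, fun hext => ?_⟩
    by_contra hnew
    exact hb (htest.2 ⟨hext, hnew⟩)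

/-! ### The search -/

/-- Notes the set at the head as the result of the search if it solves the task. -/
def recordHead : Program :=
  .setVar vOk (.const 1) ;;
  checkAll vP aInput coveredByHead ;;
  .ifElse (positive (.var vOk)) (.setVar vSolSet (.var vHeadSet)) .skip

def tryItems : Program := .forLoop vF (.var vNumItems) tryItem

def advanceHead : Program :=
  .setVar vHead (.add (.var vHead) (.const 1)) ;;
  .setVar vHeadSet (.add (.var vHeadSet) (.var vNumItems)) ;;
  .setVar vHeadFlag (.add (.var vHeadFlag) (.var aInput))

def resetQueue : Program :=
  .setVar vHead (.const 0) ;; .setVar vHeadSet (.const 0) ;; .setVar vHeadFlag (.const 0) ;;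
  .setVar vTail (.const 0) ;; .setVar vTailSet (.const 0) ;; .setVar vTailFlag (.const 0)

/-- Initialises the queue with the empty set. -/
def initSearch : Program :=
  resetQueue ;;
  writeBlock vE vNumItems aSet vTailSet (positive (.const 0)) ;;
  writeBlock vP aInput aFlag vTailFlag (.not needsTest) ;;
  advanceTail

/-- Solves the task of the current strip; a block of `aSet` at the offset `vSolSet` is the
solution. -/
def search : Program :=
  initSearch ;;
  .loop (.not (.intLe (.var vTail) (.var vHead))) (recordHead ;; tryItems ;; advanceHead)

/-- One of the first `h` sets in the queue is noted as the result of the search if one of them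
solves the task. -/
def Recorded (S : StripTask) (Q : SearchQueue) (h : ℕ) (s : Store) : Prop :=
  (∃ q < h, S.Solution (Q.set q)) →
    ∃ q < h, S.Solution (Q.set q) ∧ s.int vSolSet 0 = q * S.numItems

/-- The invariant of the search: the first `h` sets in the queue have been processed. -/
structure Searching (S : StripTask) (c : ℕ) (Q : SearchQueue) (h : ℕ) (s : Store) : Prop
    extends state : S.SearchState c Q h s where
  head_le : h ≤ Q.size
  closed : ∀ q < h, ∀ f < S.numItems, S.Extends (Q.set q) f → S.Represented Q (Q.set q) f
  recorded : Recorded S Q h s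

theorem recordHead_runs (hs : S.SearchState c Q h s) (hh : h < Q.size) (hrec : Recorded S Q h s) :
    Runs recordHead s (100 * (S.n + 1)) (Recorded S Q (h + 1)) := by
  have hinit : Runs (.setVar vOk (.const 1)) s 3 fun s' => 0 < s'.int vOk 0 :=
    .of_loopFree rfl (by decide) (by simp)
  have hcheck (s₁ : Store) (h₁ : AgreeOff (.setVar vOk (.const 1)) s s₁) (hok₁ : 0 < s₁.int vOk 0) :
      Runs (checkAll vP aInput coveredByHead) s₁ (40 * (S.n + 1)) fun s' =>
        0 < s'.int vOk 0 ↔ S.Solution (Q.set h) := by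
    have hs₁ := hs.of_agreeOff h₁
    refine (checkAll_runs (P := S.CoveredBy (Q.set h)) hs₁.held.n rfl (by decide)
      (fun p hp s₂ h₂ hvp => ?_) (by decide)).mono le_rfl fun s' _ hs' => ?_
    · rw [(hs₁.of_agreeOff h₂).holds_coveredByHead hh (hvp ▸ hp), hvp]
    · rw [hs', iff_true_intro hok₁, true_and]
      exact ⟨fun hcov => ⟨hs.valid.independent hh, hcov⟩, fun hsol => hsol.covered⟩
  refine (hinit.seq fun s₁ h₁ hok₁ => (hcheck s₁ h₁ hok₁).seq (T' := 20)
    fun s₂ h₂ hok₂ => .of_loopFree rfl (by decide) ?_).mono (by lia) fun _ _ h => h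
  have h₁₂ := h₁.seq h₂
  by_cases hsol : S.Solution (Q.set h)
  · exact fun _ => ⟨h, h.lt_succ_self, hsol, by
      simp [hok₂, hsol, (hs.of_agreeOff h₁₂).headSet]⟩
  · rintro ⟨q, hq, hqsol⟩
    have hqh : q < h := (Nat.lt_succ_iff_lt_or_eq.1 hq).resolve_right fun he => hsol (he ▸ hqsol)
    obtain ⟨r, hr, hrsol, hset⟩ := hrec ⟨q, hqh, hqsol⟩
    exact ⟨r, hr.trans h.lt_succ_self, hrsol, by simp [hok₂, hsol, h₁₂.int vSolSet rfl, hset]⟩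

theorem tryItems_runs (hs : S.SearchState c Q h s) (hh : h < Q.size) :
    Runs tryItems s (800 * ((S.numItems + 1) * (S.numItems + S.n + 1))) fun s' =>
      ∃ Q', S.SearchState c Q' h s' ∧ Q.IsPrefix Q' ∧
        ∀ f < S.numItems, S.Extends (Q.set h) f → S.Represented Q' (Q.set h) f := by
  refine (Runs.forLoop S.numItems (700 * (S.numItems + S.n + 1)) (fun j s' =>
    ∃ Q', S.SearchState c Q' h s' ∧ Q.IsPrefix Q' ∧
      ∀ f < j, S.Extends (Q.set h) f → S.Represented Q' (Q.set h) f) (b := .var vNumItems)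
    (fun s' h₁ => ?_) rfl ?_ ?_).mono ?_ fun _ _ h => h
  · rw [IntExp.eval, h₁.int vNumItems rfl]
    exact hs.held.numItems
  · exact ⟨Q, hs.of_agreeOff (.setInt s vF 0 0), .refl Q, by simp⟩
  · rintro f s₁ hf - hvf ⟨Q₁, hs₁, hQ₁, hrep₁⟩
    have hset := hQ₁.set_eq h hh
    refine (tryItem_runs hs₁ (hh.trans_le hQ₁.size_le) hvf hf).mono le_rfl ?_
    rintro s₂ - ⟨Q₂, hs₂, hQ₂, hrep₂⟩
    refine ⟨Q₂, hs₂.of_agreeOff (.setInt s₂ vF 0 (f + 1)), hQ₁.trans hQ₂, ?_⟩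
    exact Nat.forall_lt_succ_right.2 ⟨fun g hg hext => (hrep₁ g hg hext).mono hQ₂, hset ▸ hrep₂⟩
  · simp only [IntExp.cost]
    generalize S.numItems = M
    nlinarith

theorem Recorded.of_isPrefix {Q' : SearchQueue} {s' : Store} (hrec : Recorded S Q h s)
    (hQ : Q.IsPrefix Q') (hh : h ≤ Q.size) (hs : s'.int vSolSet = s.int vSolSet) :
    Recorded S Q' h s' := by
  have hset {q : ℕ} (hq : q < h) : Q'.set q = Q.set q := hQ.set_eq q (hq.trans_le hh)
  rintro ⟨q, hq, hsol⟩
  obtain ⟨r, hr, hrsol, hr'⟩ := hrec ⟨q, hq, hset hq ▸ hsol⟩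
  exact ⟨r, hr, (hset hr).symm ▸ hrsol, hs ▸ hr'⟩

theorem Searching.step (hs : Searching S c Q h s) (hh : h < Q.size) :
    Runs (recordHead ;; tryItems ;; advanceHead) s
      (950 * ((S.numItems + 1) * (S.numItems + S.n + 1))) fun s' =>
        ∃ Q', Searching S c Q' (h + 1) s' := by
  have hcost : 100 * (S.n + 1) + (800 * ((S.numItems + 1) * (S.numItems + S.n + 1)) + 40) ≤
      950 * ((S.numItems + 1) * (S.numItems + S.n + 1)) := by
    generalize S.numItems = M
    nlinarith
  refine ((recordHead_runs hs.state hh hs.recorded).seq fun s₁ h₁ hrec₁ =>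
    (tryItems_runs (hs.state.of_agreeOff h₁) hh).seq (T' := 40) fun s₂ h₂ ⟨Q', hs₂, hQ, hrep⟩ =>
      .of_loopFree rfl (by decide) ⟨Q', ?_⟩).mono hcost fun _ _ h => h
  have hkeep : AgreeOff advanceHead s₂ _ := .run rfl
  refine ⟨?_, hh.trans_le hQ.size_le, Nat.forall_lt_succ_right.2 ⟨fun q hq f hf hext => ?_, ?_⟩,
    hrec₁.of_isPrefix hQ hh ?_⟩
  · exact
      { hs₂ with
        held := hs₂.held.of_agreeOff hkeep
        head := by simp [advanceHead, hs₂.head]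
        headSet := by simp [advanceHead, hs₂.headSet, hs₂.held.numItems, add_mul]
        headFlag := by simp [advanceHead, hs₂.headFlag, hs₂.held.n, add_mul] }
  · rw [hQ.set_eq q (hq.trans hh)] at hext ⊢
    exact (hs.closed q hq f hf hext).mono hQ
  · rwa [hQ.set_eq h hh]
  · rw [hkeep.int vSolSet rfl, h₂.int vSolSet rfl]

theorem startSearch_runs (hS : S.HeldBy s) (hc : s.int vStamp 0 = c)
    (hvisited : ∀ κ, s.int aVisited κ < c)
    (hzero : ∀ v ∈ [vHead, vHeadSet, vHeadFlag, vTail, vTailSet, vTailFlag], s.int v 0 = 0)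
    (hset : ∀ e < S.numItems, s.int aSet e = 0)
    (hflag : ∀ p < S.n, 0 < s.int aFlag p ↔ S.CoveredBy ∅ p) :
    Runs advanceTail s 40 (Searching S c .initial 0) := by
  refine .of_loopFree rfl (by decide) ?_
  have hkeep : AgreeOff advanceTail s _ := .run rfl
  simp only [List.forall_mem_cons] at hzero
  obtain ⟨hhead, hheadSet, hheadFlag, htail, htailSet, htailFlag, -⟩ := hzero
  have hnot_visited (κ : ℕ) : ¬ S.Visited .initial κ :=
    fun ⟨_, hq, hq0, _⟩ => hq0 (Nat.lt_one_iff.1 hq)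
  exact
    { held := hS.of_agreeOff hkeep
      valid := .initial
      head := by simp [advanceTail, hhead]
      headSet := by simp [advanceTail, hheadSet]
      headFlag := by simp [advanceTail, hheadFlag]
      tail := by simp [advanceTail, htail, SearchQueue.initial]
      tailSet := by simp [advanceTail, htailSet, hS.numItems, SearchQueue.initial]
      tailFlag := by simp [advanceTail, htailFlag, hS.n, SearchQueue.initial]
      set := by simpa [SearchQueue.initial, advanceTail] using hset
      flag := by simpa [SearchQueue.initial, advanceTail] using hflag
      stamp := by simp [advanceTail, hc]
      visited_le κ := by rw [hkeep.int aVisited rfl]; exact (hvisited κ).le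
      visited_eq κ := by
        rw [hkeep.int aVisited rfl]
        exact iff_of_false (hvisited κ).ne (hnot_visited κ)
      head_le := Nat.zero_le _
      closed := by simp
      recorded := by simp [Recorded] }

theorem initSearch_runs (hS : S.HeldBy s) (hc : s.int vStamp 0 = c)
    (hvisited : ∀ κ, s.int aVisited κ < c) :
    Runs initSearch s (200 * (S.numItems + S.n + 1)) (Searching S c .initial 0) := by
  have hreset : Runs resetQueue s 20 fun s' =>
      ∀ v ∈ [vHead, vHeadSet, vHeadFlag, vTail, vTailSet, vTailFlag], s'.int v 0 = 0 :=
    .of_loopFree rfl (by decide) (by simp [resetQueue])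
  refine (hreset.seq fun s₁ h₁ hzero =>
    ((writeBlock_runs (P := fun _ => False) (T := 50) (hS.of_agreeOff h₁).numItems
      (hzero vTailSet (by decide)) rfl rfl (by decide) (fun _ _ _ _ _ _ => by simp)
      (by decide)).seq fun s₂ h₂ hset =>
    (writeBlock_runs (P := S.CoveredBy ∅) (T := 50) (hS.of_agreeOff (h₁.seq h₂)).n
      (by rw [h₂.int vTailFlag rfl, hzero vTailFlag (by decide)]) rfl rfl (by decide)
      (fun p _ s₃ h₃ hvp _ => ?_) (by decide)).seq fun s₃ h₃ hflag =>
      startSearch_runs (hS.of_agreeOff (h₁.seq (h₂.seq h₃))) ?_ ?_ (fun v hv => ?_) ?_ ?_)).mono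
    (by lia) fun _ _ h => h
  · rw [Test.Holds, holds_needsTest (hS.of_agreeOff (h₁.seq (h₂.seq h₃))), hvp]
    simp [CoveredBy]
  · rw [h₃.int vStamp rfl, h₂.int vStamp rfl, h₁.int vStamp rfl, hc]
  · rwa [h₃.int aVisited rfl, h₂.int aVisited rfl, h₁.int aVisited rfl]
  · rw [((h₂.seq h₃).of_keeps (ints := [vHead, vHeadSet, vHeadFlag, vTail, vTailSet, vTailFlag])
      (reals := []) rfl).1 v hv, hzero v hv]
  · rw [h₃.int aSet rfl]
    simpa using hset.1
  · simpa using hflag.1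

theorem search_runs (hS : S.HeldBy s) (hc : s.int vStamp 0 = c)
    (hvisited : ∀ κ, s.int aVisited κ < c) (hsol : ∃ F, S.Solution F) :
    Runs search s (2200 * S.searchTime) fun s' =>
      (∀ κ, s'.int aVisited κ ≤ c) ∧ ∃ A, S.Solution A ∧
        ∀ e < S.numItems, 0 < s'.int aSet (s'.int vSolSet 0 + e) ↔ e ∈ A := by
  obtain ⟨F, hF⟩ := hsol
  refine ((initSearch_runs hS hc hvisited).seq fun s₁ _ hs₁ => Runs.loop
    (fun h s => ∃ Q, Searching S c Q h s) (1 + (S.m + 1) ^ (4 * S.K))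
    (950 * ((S.numItems + 1) * (S.numItems + S.n + 1))) ⟨_, hs₁⟩ ?_).mono ?_ ?_
  · rintro h s₂ - ⟨Q, hs₂⟩ hh
    have hlt : h < Q.size := by simpa [Test.Holds, hs₂.head, hs₂.tail] using hh
    exact ⟨hlt.trans_le hs₂.valid.size_le, hs₂.step hlt⟩
  · have := Nat.one_le_pow (4 * S.K) (S.m + 1) (by lia)
    have hle : S.numItems + S.n + 1 ≤ (S.numItems + 1) * (S.numItems + S.n + 1) :=
      Nat.le_mul_of_pos_left _ (by lia)
    simp only [Test.cost, IntExp.cost, CoverTask.searchTime]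
    generalize (S.numItems + 1) * (S.numItems + S.n + 1) = W at hle ⊢
    generalize (S.m + 1) ^ (4 * S.K) = N at this ⊢
    have := Nat.le_mul_of_pos_left W this
    have := Nat.le_mul_of_pos_right N (show 0 < W by lia)
    linarith
  · rintro s₂ - ⟨h, ⟨Q, hs₂⟩, hh⟩
    have hle : Q.size ≤ h := by simpa [Test.Holds, hs₂.head, hs₂.tail] using hh
    obtain rfl := le_antisymm hle hs₂.head_le
    obtain ⟨q, hq, hcov⟩ := hs₂.valid.exists_covering hs₂.closed hF
    obtain ⟨r, hr, hsol, hset⟩ := hs₂.recorded ⟨q, hq, hs₂.valid.independent hq, hcov⟩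
    exact ⟨hs₂.visited_le, _, hsol, fun e he => hset ▸ hs₂.set r hr e he⟩

end CoverProgram

namespace CoverProgram

/-! ### Selecting the next strip -/

/-- The point `vP` lies above all the `vStamp` strips. Only the last one, which begins at the
height `vBase`, has to be examined. -/
def aboveTest : Test :=
  or (.intLe (.var vStamp) (.const 0)) (.realLe (.add base (.const (7 / 5))) pointY)

/-- The point `vP` lies above the strips and below the points found so far. -/
def lowerTest : Test :=
  .and aboveTest
    (.not (.and (positive (.var vFound)) (.realLe (.get vNextBase (.const 0)) pointY)))

def select : Program :=
  .setVar vFound (.const 0) ;;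
  .forLoop vP (.var aInput) (.ifElse lowerTest
    (.setReal vNextBase (.const 0) pointY ;; .setVar vFound (.const 1)) .skip) ;;
  .setReal vBase (.const 0) (.get vNextBase (.const 0))

/-- The real variable `v` holds the least element of `H`, if `H` is nonempty. -/
structure FoundLeast (H : Set ℝ) (v : ℕ) (s : Store) : Prop where
  found : 0 < s.int vFound 0 ↔ H.Nonempty
  isLeast : H.Nonempty → IsLeast H (s.real v 0)

section Select

variable {B : CoverTask} {Z : StripSequence} {s : Store}

theorem FoundLeast.step {j : ℕ} (h : FoundLeast (B.heightsAbove Z j) vNextBase s)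
    (hpy : s.real aPointY = B.py) (hj : s.int vP 0 = j)
    (habove : aboveTest.Holds s ↔ B.Above Z j) :
    Runs (.ifElse lowerTest (.setReal vNextBase (.const 0) pointY ;; .setVar vFound (.const 1))
      .skip) s (lowerTest.cost + 10) (FoundLeast (B.heightsAbove Z (j + 1)) vNextBase) := by
  have hlower : lowerTest.Holds s ↔ B.Above Z j ∧
      ((B.heightsAbove Z j).Nonempty → B.py j < s.real vNextBase 0) := by
    simp [lowerTest, Test.Holds, habove, ← h.found, hj, hpy, Nat.succ_le_iff]
  refine Runs.ifElse (fun hh => ?_) fun hh => ?_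
  · obtain ⟨hj_above, hlt⟩ := hlower.1 hh
    refine .of_loopFree rfl (by decide) ?_
    rw [CoverTask.heightsAbove_succ_of_above hj_above]
    refine ⟨by simp, fun _ => ?_⟩
    rcases (B.heightsAbove Z j).eq_empty_or_nonempty with hempty | hne
    · simp [hempty, hj, hpy]
    · simpa [hj, hpy, min_eq_left (hlt hne).le] using (h.isLeast hne).insert (B.py j)
  · refine .of_loopFree rfl (by decide) ?_
    by_cases hj_above : B.Above Z j
    · obtain ⟨hne, hle⟩ : (B.heightsAbove Z j).Nonempty ∧ s.real vNextBase 0 ≤ B.py j := by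
        simpa [hlower, hj_above] using hh
      rw [CoverTask.heightsAbove_succ_of_above hj_above]
      refine ⟨iff_of_true (h.found.2 hne) (Set.insert_nonempty _ _), fun _ => ?_⟩
      simpa [min_eq_right hle] using (h.isLeast hne).insert (B.py j)
    · rwa [CoverTask.heightsAbove_succ_of_not_above hj_above]

theorem select_runs (hn : s.int aInput 0 = B.n) (hpy : s.real aPointY = B.py)
    (habove : ∀ p, B.Above Z p ↔ s.int vStamp 0 = 0 ∨ s.real vBase 0 + 7 / 5 ≤ B.py p) :
    Runs select s (70 * (B.n + 1)) (FoundLeast (B.heightsAbove Z B.n) vBase) := by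
  have hclear : Runs (.setVar vFound (.const 0)) s 5 (FoundLeast ∅ vNextBase) :=
    .of_loopFree rfl (by decide) ⟨by simp, by simp⟩
  refine (hclear.seq fun s₁ h₁ hs₁ => (Runs.forLoop B.n (lowerTest.cost + 10)
    (fun j => FoundLeast (B.heightsAbove Z j) vNextBase) ?_ rfl ?_ ?_).seq fun s₂ _ hs₂ =>
      Runs.of_loopFree (T := 10) rfl (by decide) ?_).mono ?_ fun _ _ h => h
  · intro s₂ h₂
    simpa [h₂.int aInput rfl, h₁.int aInput rfl] using hn
  · have hempty : B.heightsAbove Z 0 = ∅ := by simp [CoverTask.heightsAbove]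
    rw [hempty]
    exact ⟨by simpa using hs₁.found, by simp⟩
  · intro j s₂ _ h₂ hvj hs₂
    have hpy₂ : s₂.real aPointY = B.py := by rw [h₂.real aPointY rfl, h₁.real aPointY rfl, hpy]
    refine (hs₂.step hpy₂ hvj ?_).mono le_rfl fun s₃ _ h => ⟨by simpa using h.found, h.isLeast⟩
    rw [aboveTest, holds_or, habove]
    simp [Test.Holds, hpy₂, hvj, h₂.int vStamp rfl, h₁.int vStamp rfl, h₂.real vBase rfl,
      h₁.real vBase rfl]
  · exact ⟨by simpa using hs₂.found, by simpa using hs₂.isLeast⟩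
  · have hcost : lowerTest.cost ≤ 30 := by decide
    simp only [IntExp.cost]
    nlinarith

end Select

/-! ### The whole program -/

/-- Colours the disks of the solution of the strip. -/
def writeOutput : Program :=
  .forLoop vE (.var vNumItems)
    (.ifElse (positive (.get aSet (.add (.var vSolSet) (.var vE))))
      (.setInt aOut (.get aDisk (.var vE))
        (.add (.add (.var vOffset) (.get aColor (.var vE))) (.const 1))) .skip)

def nextOffset : Program :=
  .setVar vOffset (.add (.var vOffset) (.var vK)) ;;
  .ifElse (.intLe (.add (.add (.var vK) (.var vK)) (.add (.var vK) (.var vK))) (.var vOffset))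
    (.setVar vOffset (.const 0)) .skip

def processStrip : Program :=
  .setVar vStamp (.add (.var vStamp) (.const 1)) ;; search ;; writeOutput ;; nextOffset ;; select

/-- Sets `vK` to the minimum of the number of colours and the number of disks, since no more colours
than disks are needed. -/
def minColors : Program :=
  .ifElse (.intLe (.get aInput (.const 1)) (.get aInput (.const 2)))
    (.setVar vK (.get aInput (.const 1))) (.setVar vK (.get aInput (.const 2)))

/-- Adds the item with the disk `vE` and the colour `vColor` to the tables. -/
def listItem : Program :=
  .setInt aDisk (.var vNumItems) (.var vE) ;; .setInt aColor (.var vNumItems) (.var vColor) ;;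
  .setInt aPow (.var vNumItems) (.var vPow) ;; .setVar vPow (.add (.var vPow) (.var vPow)) ;;
  .setVar vNumItems (.add (.var vNumItems) (.const 1))

def setup : Program :=
  (minColors ;; .setVar vPow (.const 1)) ;;
  .forLoop vColor (.var vK) (.forLoop vE (.get aInput (.const 1)) listItem)

/-- The approximation algorithm. -/
def main : Program := (setup ;; select) ;; .loop (positive (.var vFound)) processStrip

/-- The memory holds the first `M` items of the tables for `m` disks. -/
structure Listed (m M : ℕ) (s : Store) : Prop where
  numItems : s.int vNumItems 0 = M
  nextPow : s.int vPow 0 = 2 ^ M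
  disk : ∀ e < M, s.int aDisk e = e % m
  color : ∀ e < M, s.int aColor e = e / m
  pow : ∀ e < M, s.int aPow e = 2 ^ e

/-- The memory between two strips, when those of `Z` have been processed. -/
structure Processed (B : CoverTask) (Z : StripSequence) (s : Store) : Prop where
  held : B.HeldBy s
  valid : B.ValidStrips Z
  output : B.OutputOf Z (s.int aOut)
  next : FoundLeast (B.heightsAbove Z B.n) vBase s
  offset : s.int vOffset 0 = Z.length % 4 * B.K
  stamp : s.int vStamp 0 = Z.length
  visited_le : ∀ κ, s.int aVisited κ ≤ Z.length

section ProcessStrip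

variable {B : CoverTask} {Z : StripSequence} {s : Store}

theorem writeOutput_runs (hB : B.HeldBy s) {A : Finset ℕ} {r : ℕ} (hA : ∀ e ∈ A, e < B.numItems)
    (hset : ∀ e < B.numItems, 0 < s.int aSet (s.int vSolSet 0 + e) ↔ e ∈ A)
    (hoffset : s.int vOffset 0 = r * B.K) :
    Runs writeOutput s (60 * (B.numItems + 1)) fun s' =>
      B.Overwrites (s.int aOut) r A (s'.int aOut) := by
  refine (Runs.forLoop B.numItems 40 (fun i s' =>
      B.Overwrites (s.int aOut) r (A.filter (· < i)) (s'.int aOut)) ?_ rfl ?_ ?_).mono ?_ ?_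
  · exact fun s₁ h₁ => (hB.of_agreeOff h₁).numItems
  · exact ⟨by simp, by simp⟩
  · intro i s₁ hi h₁ hv hs₁
    have hB₁ := hB.of_agreeOff h₁
    have htest : s₁.int aSet (s₁.int vSolSet 0 + i) = s.int aSet (s.int vSolSet 0 + i) := by
      rw [h₁.int aSet rfl, h₁.int vSolSet rfl]
    have hoffset₁ : s₁.int vOffset 0 = r * B.K := by rw [h₁.int vOffset rfl, hoffset]
    refine .of_loopFree rfl (by decide) ?_
    by_cases hiA : i ∈ A
    · have hfilter : A.filter (· < i + 1) = insert i (A.filter (· < i)) := by grind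
      rw [hfilter]
      simpa [hv, htest, (hset i hi).2 hiA, hB₁.disk i hi, hB₁.color i hi, hoffset₁]
        using hs₁.insert i
    · have hfilter : A.filter (· < i + 1) = A.filter (· < i) := by grind
      rw [hfilter]
      simpa [hv, htest, mt (hset i hi).1 hiA] using hs₁
  · simp only [IntExp.cost]
    lia
  · intro s₁ _ hs₁
    rwa [Finset.filter_true_of_mem hA] at hs₁

theorem nextOffset_runs {K j : ℕ} (hK : 0 < K) (hvK : s.int vK 0 = K)
    (hoffset : s.int vOffset 0 = j % 4 * K) :
    Runs nextOffset s 40 fun s' => s'.int vOffset 0 = (j + 1) % 4 * K := by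
  refine .of_loopFree rfl (by decide) ?_
  have hwrap : (j + 1) % 4 * K =
      if K + K + (K + K) ≤ j % 4 * K + K then 0 else j % 4 * K + K := by
    rcases (by lia : (j + 1) % 4 = j % 4 + 1 ∧ j % 4 ≤ 2 ∨ (j + 1) % 4 = 0 ∧ j % 4 = 3) with
      ⟨hmod, hle⟩ | ⟨hmod, heq⟩
    · have := Nat.mul_le_mul_right K hle
      rw [hmod, if_neg (by lia)]
      ring
    · rw [hmod, heq, if_pos (by lia), zero_mul]
  rw [hwrap]
  by_cases h : K + K + (K + K) ≤ j % 4 * K + K <;>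
    simp [nextOffset, Test.Holds, hvK, hoffset, h]

theorem Processed.step (h : Processed B Z s) (hK : 0 < B.K) {G : Finset ℕ} (hG : B.Solution G)
    (hfound : 0 < s.int vFound 0) :
    Runs processStrip s (2500 * B.searchTime) fun s' =>
      ∃ A, Processed B (Z.push (s.real vBase 0) A) s' := by
  have hleast : IsLeast (B.heightsAbove Z B.n) (s.real vBase 0) :=
    h.next.isLeast (h.next.found.1 hfound)
  have hstamp : Runs (.setVar vStamp (.add (.var vStamp) (.const 1))) s 10 fun s' =>
      s'.int vStamp 0 = Z.length + 1 := .of_loopFree rfl (by decide) (by simp [h.stamp])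
  refine (hstamp.seq fun s₁ h₁ hstamp₁ => ?_).mono (T := 10 + (2200 * B.searchTime +
    (60 * (B.numItems + 1) + (40 + 70 * (B.n + 1))))) ?_ fun _ _ h => h
  · have hB₁ := h.held.of_agreeOff h₁
    refine (search_runs (S := B.strip (s.real vBase 0)) ⟨hB₁, h₁.real vBase rfl ▸ rfl⟩ hstamp₁
      (fun κ => ?_) (hG.exists_strip_solution _)).seq fun s₂ h₂ ⟨hvisited, A, hA, hset⟩ => ?_
    · rw [h₁.int aVisited rfl]
      exact Nat.lt_succ_of_le (h.visited_le κ)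
    have hB₂ := hB₁.of_agreeOff h₂
    refine (writeOutput_runs (r := Z.length % 4) hB₂ hA.lt hset ?_).seq fun s₃ h₃ hout => ?_
    · rw [h₂.int vOffset rfl, h₁.int vOffset rfl, h.offset]
    have hB₃ := hB₂.of_agreeOff h₃
    refine (nextOffset_runs (j := Z.length) hK hB₃.K ?_).seq fun s₄ h₄ hoffset => ?_
    · rw [h₃.int vOffset rfl, h₂.int vOffset rfl, h₁.int vOffset rfl, h.offset]
    have hB₄ := hB₃.of_agreeOff h₄
    have hstamp₄ : s₄.int vStamp 0 = Z.length + 1 := by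
      rw [h₄.int vStamp rfl, h₃.int vStamp rfl, h₂.int vStamp rfl, hstamp₁]
    have hbase₄ : s₄.real vBase 0 = s.real vBase 0 := by
      rw [h₄.real vBase rfl, h₃.real vBase rfl, h₂.real vBase rfl, h₁.real vBase rfl]
    refine (select_runs (Z := Z.push (s.real vBase 0) A) hB₄.n hB₄.py fun p => ?_).mono le_rfl
      fun s₅ h₅ hnext => ⟨A, hB₄.of_agreeOff h₅, h.valid.push hleast hA, h.output.push _ ?_, hnext,
        ?_, ?_, ?_⟩
    · rw [CoverTask.above_push_iff_of_isLeast hleast, hstamp₄, hbase₄]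
      simp
    · rwa [h₅.int aOut rfl, h₄.int aOut rfl, ← h₁.int aOut rfl, ← h₂.int aOut rfl]
    · rwa [h₅.int vOffset rfl]
    · rwa [h₅.int vStamp rfl]
    · rwa [h₅.int aVisited rfl, h₄.int aVisited rfl, h₃.int aVisited rfl]
  · have := B.numItems_add_n_le_searchTime
    lia

end ProcessStrip

section Setup

variable {B : CoverTask} {s s' : Store} {m M K c d : ℕ}

theorem Listed.of_agreeOff (h : Listed m M s) {p : Program} (hs : AgreeOff p s s')
    (hp : p.keeps [vNumItems, vPow, aDisk, aColor, aPow] [] = true := by rfl) :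
    Listed m M s' := by
  have hkeep := (hs.of_keeps hp).1
  simp only [List.forall_mem_cons] at hkeep
  obtain ⟨hM, hP, hd, hc, hw, -⟩ := hkeep
  exact ⟨hM ▸ h.numItems, hP ▸ h.nextPow, hd ▸ h.disk, hc ▸ h.color, hw ▸ h.pow⟩

theorem Listed.step (h : Listed m (c * m + d) s) (hd : d < m) (hvColor : s.int vColor 0 = c)
    (hvE : s.int vE 0 = d) : Runs listItem s 28 (Listed m (c * m + d + 1)) := by
  have hmod : (c * m + d) % m = d := Nat.mul_add_mod_of_lt hd
  have hdiv : (c * m + d) / m = c := by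
    rw [mul_comm, Nat.mul_add_div (by lia), Nat.div_eq_of_lt hd, add_zero]
  have hupdate {t : ℕ → ℕ} {g : ℕ → ℕ} (ht : ∀ e < c * m + d, t e = g e) :
      ∀ e < c * m + d + 1, Function.update t (c * m + d) (g (c * m + d)) e = g e :=
    Nat.forall_lt_succ_right.2
      ⟨fun e he => by rw [Function.update_of_ne he.ne, ht e he], Function.update_self _ _ _⟩
  refine .of_loopFree rfl (by decide) ⟨?_, ?_, ?_, ?_, ?_⟩
  · simp [listItem, h.numItems]
  · simp [listItem, h.nextPow, pow_succ, mul_two]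
  · simpa [listItem, h.numItems, hvE, hmod] using hupdate h.disk
  · simpa [listItem, h.numItems, hvColor, hdiv] using hupdate h.color
  · simpa [listItem, h.numItems, h.nextPow] using hupdate h.pow

theorem listItems_runs (hm : s.int aInput 1 = m) (hK : s.int vK 0 = K) (h : Listed m 0 s) :
    Runs (.forLoop vColor (.var vK) (.forLoop vE (.get aInput (.const 1)) listItem)) s
      (50 * (m * K + K + 1)) (Listed m (m * K)) := by
  refine (Runs.forLoop K (m * 40 + 15) (fun c s' => Listed m (c * m) s') ?_ rfl ?_ ?_).mono ?_
    fun _ _ h => mul_comm m K ▸ h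
  · exact fun s₁ h₁ => (congrFun (h₁.int vK rfl) 0).trans hK
  · simpa using h.of_agreeOff (.setInt s vColor 0 0)
  · intro c s₁ _ h₁ hvColor hs₁
    refine (Runs.forLoop m 28 (fun d s' => Listed m (c * m + d) s') ?_ rfl
      (hs₁.of_agreeOff (.setInt s₁ vE 0 0)) ?_).mono ?_ ?_
    · exact fun s₂ h₂ => (h₂.int aInput rfl ▸ h₁.int aInput rfl ▸ hm :)
    · intro d s₂ hd h₂ hvE hs₂
      exact (hs₂.step hd (by rw [h₂.int vColor rfl, hvColor]) hvE).mono le_rfl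
        fun s₃ _ hs₃ => hs₃.of_agreeOff (.setInt s₃ vE 0 (d + 1))
    · simp only [IntExp.cost]
      lia
    · intro s₂ _ hs₂
      rw [Nat.succ_mul]
      exact hs₂.of_agreeOff (.setInt s₂ vColor 0 (c + 1))
  · simp only [IntExp.cost]
    nlinarith

theorem setup_runs (h : B.InputOf s) :
    Runs setup s (100 * (B.numItems + 1)) B.HeldBy := by
  have hstart : Runs (minColors ;; .setVar vPow (.const 1)) s 20 fun s' =>
      s'.int vK 0 = B.K ∧ s'.int vPow 0 = 1 := by
    refine .of_loopFree rfl (by decide) ?_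
    rw [← h.K]
    rcases le_or_gt B.m (s.int aInput 2) with hle | hlt
    · simp [minColors, Test.Holds, h.m, hle]
    · simp [minColors, Test.Holds, h.m, hlt.not_ge, hlt.le]
  refine (hstart.seq fun s₁ h₁ ⟨hK, hpow⟩ => (listItems_runs (m := B.m) ?_ hK ?_).mono le_rfl
    fun s₂ h₂ hl => ?_).mono ?_ fun _ _ h => h
  · rw [h₁.int aInput rfl, h.m]
  · refine ⟨?_, hpow, by simp, by simp, by simp⟩
    rw [h₁.int vNumItems rfl, h.zero _ (by decide)]
  · have hs : AgreeOff setup s s₂ := h₁.seq h₂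
    exact {
      n := by rw [hs.int aInput rfl, h.n]
      numItems := hl.numItems
      K := by rw [h₂.int vK rfl, hK]
      disk := hl.disk
      color := hl.color
      pow := hl.pow
      px := by rw [hs.real aPointX rfl, h.px]
      py := by rw [hs.real aPointY rfl, h.py]
      dx := by rw [hs.real aDiskX rfl, h.dx]
      dy := by rw [hs.real aDiskY rfl, h.dy] }
  · have hKm : B.K ≤ B.m := h.K ▸ min_le_right _ _
    have hK_le : B.K ≤ B.numItems := (Nat.le_mul_self _).trans (Nat.mul_le_mul_right _ hKm)
    lia

theorem Processed.empty (h : B.InputOf s) (hs : AgreeOff (setup ;; select) s s')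
    (hB : B.HeldBy s') (hnext : FoundLeast (B.heightsAbove .empty B.n) vBase s') :
    Processed B .empty s' where
  held := hB
  valid := .empty
  output := by
    rw [hs.int aOut rfl, funext (h.zero aOut (by decide))]
    exact ⟨by simp [StripSequence.empty], by simp⟩
  next := hnext
  offset := by
    rw [hs.int vOffset rfl, h.zero _ (by decide)]
    simp [StripSequence.empty]
  stamp := by rw [hs.int vStamp rfl, h.zero _ (by decide), StripSequence.empty]
  visited_le κ := by rw [hs.int aVisited rfl, h.zero _ (by decide)]; exact Nat.zero_le _

theorem start_runs (h : B.InputOf s) :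
    Runs (setup ;; select) s (100 * (B.numItems + 1) + 70 * (B.n + 1)) (Processed B .empty) := by
  have hrun : Runs (setup ;; select) s (100 * (B.numItems + 1) + 70 * (B.n + 1)) fun s' =>
      B.HeldBy s' ∧ FoundLeast (B.heightsAbove .empty B.n) vBase s' := by
    refine (setup_runs h).seq fun s₁ h₁ hB => (select_runs hB.n hB.py fun p => ?_).mono le_rfl
      fun s₂ h₂ hnext => ⟨hB.of_agreeOff h₂, hnext⟩
    rw [h₁.int vStamp rfl, h.zero _ (by decide)]
    simp [CoverTask.Above, StripSequence.empty]
  exact hrun.mono le_rfl fun s' hs ⟨hB, hnext⟩ => .empty h hs hB hnext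

end Setup

theorem main_runs {B : CoverTask} {s : Store} (h : B.InputOf s) (hn : 0 < B.n) {G : Finset ℕ}
    (hG : B.Solution G) :
    Runs main s (3000 * (min B.n (2 * B.m) * B.searchTime)) fun s' =>
      ∃ Z, B.ValidStrips Z ∧ B.OutputOf Z (s'.int aOut) ∧ ∀ p < B.n, ¬ B.Above Z p := by
  have hM := hG.numItems_pos hn
  refine ((start_runs h).seq fun s₁ _ hs₁ => (Runs.loop
    (fun j s' => ∃ Z, Z.length = j ∧ Processed B Z s') (min B.n (2 * B.m)) (2500 * B.searchTime)
    ⟨_, rfl, hs₁⟩ ?_).mono le_rfl ?_).mono ?_ fun _ _ h => h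
  · rintro _ s₂ - ⟨Z, rfl, hs₂⟩ hfound
    obtain ⟨F, hF⟩ := hG.exists_strip_solution (s₂.real vBase 0)
    have hpush := hs₂.valid.push (hs₂.next.isLeast (hs₂.next.found.1 hfound)) hF
    exact ⟨lt_min hpush.length_le_n (hpush.length_le_two_mul hG),
      (hs₂.step (Nat.pos_of_mul_pos_left hM) hG hfound).mono le_rfl
        fun s₃ _ ⟨A, hs₃⟩ => ⟨_, rfl, hs₃⟩⟩
  · rintro s₂ - ⟨_, ⟨Z, -, hs₂⟩, hnot⟩
    refine ⟨Z, hs₂.valid, hs₂.output, fun p hp hopen => hnot ?_⟩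
    exact hs₂.next.found.2 ⟨_, p, ⟨hp, hopen⟩, rfl⟩
  · have hm : 0 < B.m := Nat.pos_of_mul_pos_right hM
    have hstrips : 0 < min B.n (2 * B.m) := lt_min hn (by lia)
    have hsearch := B.numItems_add_n_le_searchTime
    have htime := Nat.le_mul_of_pos_left B.searchTime hstrips
    have hloop := Nat.le_mul_of_pos_right (min B.n (2 * B.m)) (by lia : 0 < B.searchTime)
    have hcost : (positive (.var vFound)).cost = 4 := rfl
    rw [hcost]
    calc 100 * (B.numItems + 1) + 70 * (B.n + 1) +
          (min B.n (2 * B.m) * (4 + 2500 * B.searchTime) + 4)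
        ≤ 174 * B.searchTime +
          (4 * min B.n (2 * B.m) + 2500 * (min B.n (2 * B.m) * B.searchTime)) := by
          rw [mul_add, mul_left_comm]
          lia
      _ ≤ 3000 * (min B.n (2 * B.m) * B.searchTime) := by lia

end CoverProgram

/-! ### Instances of the problem -/

theorem mem_unitDisk_iff {p c : Plane} :
    p ∈ unitDisk c ↔ (p 0 - c 0) * (p 0 - c 0) + (p 1 - c 1) * (p 1 - c 1) ≤ 1 := by
  rw [unitDisk, Metric.mem_closedBall, EuclideanSpace.dist_eq, Real.sqrt_le_one, Fin.sum_univ_two,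
    Real.dist_eq, Real.dist_eq, sq_abs, sq_abs, pow_two, pow_two]

theorem unitDisk_inter_nonempty_iff_dist_le {a b : Plane} :
    (unitDisk a ∩ unitDisk b).Nonempty ↔ dist a b ≤ 2 := by
  constructor
  · rintro ⟨z, hz, hz'⟩
    rw [unitDisk, Metric.mem_closedBall] at hz hz'
    linarith [dist_triangle_left a b z]
  · intro h
    refine ⟨midpoint ℝ a b, ?_, ?_⟩
    · rw [unitDisk, Metric.mem_closedBall, dist_midpoint_left, Real.norm_ofNat]
      linarith
    · rw [unitDisk, Metric.mem_closedBall, dist_midpoint_right, Real.norm_ofNat]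
      linarith

theorem unitDisk_inter_nonempty_iff {a b : Plane} :
    (unitDisk a ∩ unitDisk b).Nonempty ↔
      (a 0 - b 0) * (a 0 - b 0) + (a 1 - b 1) * (a 1 - b 1) ≤ 4 := by
  rw [unitDisk_inter_nonempty_iff_dist_le, EuclideanSpace.dist_eq, Real.sqrt_le_left zero_le_two,
    Fin.sum_univ_two, Real.dist_eq, Real.dist_eq, sq_abs, sq_abs, pow_two, pow_two]
  norm_num

theorem eq_and_eq_of_mul_add_eq_mul_add {K q q' r r' : ℕ} (hr : r < K) (hr' : r' < K)
    (h : q * K + r = q' * K + r') : q = q' ∧ r = r' := by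
  have hrem := congrArg (· % K) h
  simp only [Nat.mul_add_mod_of_lt, hr, hr'] at hrem
  rw [hrem] at h
  exact ⟨Nat.eq_of_mul_eq_mul_right (Nat.zero_lt_of_lt hr) (Nat.add_right_cancel h), hrem⟩

section Instance

variable {n m : ℕ} (P : Fin n → Plane) (D : Fin m → Plane) (k : ℕ)

/-- The task of an instance of the problem; no more colours are used than there are disks. -/
noncomputable def instanceTask : CoverTask where
  n := n
  m := m
  K := min k m
  px := (inputStore P D k).real aPointX
  py := (inputStore P D k).real aPointY
  dx := (inputStore P D k).real aDiskX
  dy := (inputStore P D k).real aDiskY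

theorem instanceTask_inputOf : (instanceTask P D k).InputOf (inputStore P D k) where
  n := by simp [inputStore, instanceTask]
  m := by simp [inputStore, instanceTask]
  K := by simp [inputStore, instanceTask]
  zero := by simp +contextual [inputStore]
  px := rfl
  py := rfl
  dx := rfl
  dy := rfl

variable {P D k}

theorem instanceTask_covers_iff {e p : ℕ} (hp : p < n) {d : Fin m} (hd : e % m = d) :
    (instanceTask P D k).Covers e p ↔ P ⟨p, hp⟩ ∈ unitDisk (D d) := by
  rw [mem_unitDisk_iff]
  simp [CoverTask.Covers, CoverTask.x, CoverTask.y, instanceTask, inputStore, hp, hd]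

theorem instanceTask_conflict_iff {e f : ℕ} {d d' : Fin m} (hd : e % m = d) (hd' : f % m = d') :
    (instanceTask P D k).Conflict e f ↔
      e / m = f / m ∧ (unitDisk (D d) ∩ unitDisk (D d')).Nonempty := by
  rw [unitDisk_inter_nonempty_iff]
  simp [CoverTask.Conflict, CoverTask.x, CoverTask.y, instanceTask, inputStore, hd, hd']

theorem HasColorableCover.exists_color_lt_min (h : HasColorableCover P D k) :
    ∃ (S : Finset (Fin m)) (c : Fin m → ℕ),
      (∀ p, ∃ d ∈ S, P p ∈ unitDisk (D d)) ∧ (∀ d ∈ S, c d < min k m) ∧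
      ∀ d ∈ S, ∀ d' ∈ S, d ≠ d' → (unitDisk (D d) ∩ unitDisk (D d')).Nonempty → c d ≠ c d' := by
  obtain ⟨S, χ, hcov, hcol, hproper⟩ := h
  rcases le_total m k with hmk | hkm
  · exact ⟨S, fun d => d, hcov, fun d _ => by simp [hmk],
      fun d _ d' _ hne _ heq => hne (Fin.ext heq)⟩
  · refine ⟨S, fun d => χ d - 1, hcov, fun d hd => ?_, fun d hd d' hd' hne hint heq => ?_⟩
    · have := Finset.mem_Icc.1 (hcol d hd)
      rw [min_eq_left hkm]
      lia
    · have hχ := Finset.mem_Icc.1 (hcol d hd)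
      have hχ' := Finset.mem_Icc.1 (hcol d' hd')
      exact hproper d hd d' hd' hne hint (by lia)

theorem HasColorableCover.exists_solution (h : HasColorableCover P D k) :
    ∃ G, (instanceTask P D k).Solution G := by
  classical
  obtain ⟨S, c, hcov, hcol, hproper⟩ := h.exists_color_lt_min
  have hmod (d : Fin m) : (m * c d + d) % m = d := by
    rw [Nat.mul_add_mod, Nat.mod_eq_of_lt d.2]
  have hdiv (d : Fin m) : (m * c d + d) / m = c d := by
    rw [Nat.mul_add_div d.pos, Nat.div_eq_of_lt d.2, add_zero]
  refine ⟨S.image fun d => m * c d + d, ?_, ?_, ?_⟩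
  · rw [Finset.forall_mem_image]
    intro d hd
    calc m * c d + d < m * (c d + 1) := by lia
      _ ≤ m * min k m := Nat.mul_le_mul_left m (hcol d hd)
  · rw [Finset.forall_mem_image]
    intro d hd
    rw [Finset.forall_mem_image]
    intro d' hd' hne
    rw [instanceTask_conflict_iff (hmod d) (hmod d'), hdiv, hdiv]
    rintro ⟨heq, hint⟩
    exact hproper d hd d' hd' (by rintro rfl; exact hne rfl) hint heq
  · intro p hp
    obtain ⟨d, hd, hpd⟩ := hcov ⟨p, hp⟩
    exact ⟨_, Finset.mem_image_of_mem _ hd, (instanceTask_covers_iff hp (hmod d)).2 hpd⟩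

theorem mem_outputDisks_iff {s : Store} {d : Fin m} : d ∈ outputDisks s m ↔ 0 < s.int aOut d := by
  rw [outputDisks, Finset.mem_filter_univ, outputColor, Nat.pos_iff_ne_zero]

theorem isColoredCover_of_outputOf {Z : StripSequence} {s : Store}
    (hZ : (instanceTask P D k).ValidStrips Z) (hout : (instanceTask P D k).OutputOf Z (s.int aOut))
    (hbelow : ∀ p < n, ¬ (instanceTask P D k).Above Z p) :
    IsColoredCover P D (4 * k) (outputDisks s m) fun d => outputColor s d := by
  have hlt : ∀ i < Z.length, ∀ e ∈ Z.items i, e / m < min k m := fun i hi e he =>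
    Nat.div_lt_of_lt_mul ((hZ.independent i hi).lt e he)
  refine ⟨fun p => ?_, fun d hd => ?_, fun d hd d' hd' hne hint heq => ?_⟩
  · obtain ⟨i, hi, e, he, hep⟩ := hZ.covered p p.2 (hbelow p p.2)
    have hm : 0 < m := (Nat.zero_le _).trans_lt ((hlt i hi e he).trans_le (min_le_right _ _))
    exact ⟨⟨e % m, Nat.mod_lt _ hm⟩, mem_outputDisks_iff.2 (hout.pos i hi e he),
      (instanceTask_covers_iff p.2 rfl).1 hep⟩
  · obtain ⟨i, hi, e, he, -, hcol⟩ := hout.color d (mem_outputDisks_iff.1 hd)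
    have hcolor : s.int aOut d = i % 4 * min k m + e / m + 1 := hcol
    have hlt_e := hlt i hi e he
    have hpalette : i % 4 * min k m ≤ 3 * min k m := Nat.mul_le_mul_right _ (by lia)
    change s.int aOut d ∈ Finset.Icc 1 (4 * k)
    rw [Finset.mem_Icc, hcolor]
    lia
  · obtain ⟨i, hi, e, he, hed, hcol⟩ := hout.color d (mem_outputDisks_iff.1 hd)
    obtain ⟨i', hi', f, hf, hfd, hcol'⟩ := hout.color d' (mem_outputDisks_iff.1 hd')
    have hcodes : i % 4 * min k m + e / m = i' % 4 * min k m + f / m :=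
      Nat.succ_injective (hcol.symm.trans (heq.trans hcol'))
    obtain ⟨hpalette, hcolor⟩ :=
      eq_and_eq_of_mul_add_eq_mul_add (hlt i hi e he) (hlt i' hi' f hf) hcodes
    have hef : e ≠ f := by
      rintro rfl
      exact hne (Fin.ext (hed.symm.trans hfd))
    exact hZ.not_conflict hi hi' hpalette he hf hef
      ((instanceTask_conflict_iff hed hfd).2 ⟨hcolor, hint⟩)

end Instance

/-! ### The running time -/

section RunningTime

variable {m K : ℕ}

theorem mul_sq_le_pow_two_mul (hK : 0 < K) (hKm : K ≤ m) : (m * K) ^ 2 ≤ m ^ (2 * K) := by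
  rw [pow_mul']
  refine Nat.pow_le_pow_left ?_ 2
  obtain rfl | hK₂ : K = 1 ∨ 2 ≤ K := by lia
  · simp
  · calc m * K ≤ m ^ 2 := by rw [pow_two]; exact Nat.mul_le_mul_left m hKm
      _ ≤ m ^ K := Nat.pow_le_pow_right (by lia) hK₂

theorem add_one_pow_le_exp_mul_pow (hm : 0 < m) (hKm : K ≤ m) :
    ((m : ℝ) + 1) ^ (4 * K) ≤ Real.exp 4 * (m : ℝ) ^ (4 * K) := by
  have hm' : (0 : ℝ) < m := by exact_mod_cast hm
  have hexp : (m : ℝ) + 1 ≤ Real.exp (1 / m) * m :=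
    calc (m : ℝ) + 1 = (1 / (m : ℝ) + 1) * m := by field_simp; ring
      _ ≤ Real.exp (1 / m) * m := by gcongr; exact Real.add_one_le_exp _
  calc ((m : ℝ) + 1) ^ (4 * K) ≤ (Real.exp (1 / m) * m) ^ (4 * K) := by gcongr
    _ = Real.exp ((4 * K : ℕ) * (1 / m)) * (m : ℝ) ^ (4 * K) := by rw [mul_pow, Real.exp_nat_mul]
    _ ≤ Real.exp 4 * (m : ℝ) ^ (4 * K) := by
      gcongr
      rw [mul_one_div, div_le_iff₀ hm']
      exact_mod_cast Nat.mul_le_mul_left 4 hKm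

theorem min_mul_succ_le {M n : ℕ} (hM : 0 < M) (hmM : m ≤ M) :
    min n (2 * m) * (M + n + 1) ≤ 4 * (M * n) :=
  calc min n (2 * m) * (M + n + 1) ≤ min n (2 * m) * (2 * M) + min n (2 * m) * n := by
        rw [← mul_add]
        exact Nat.mul_le_mul_left _ (by lia)
    _ ≤ n * (2 * M) + 2 * M * n := by gcongr <;> lia
    _ = 4 * (M * n) := by ring

theorem CoverTask.min_mul_searchTime_le {B : CoverTask} (hm : 0 < B.m) (hK : 0 < B.K)
    (hKm : B.K ≤ B.m) :
    min B.n (2 * B.m) * B.searchTime ≤ 8 * ((B.m + 1) ^ (4 * B.K) * (B.m ^ (2 * B.K) * B.n)) := by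
  have hM : 0 < B.numItems := Nat.mul_pos hm hK
  have hstrips := min_mul_succ_le (n := B.n) hM (Nat.le_mul_of_pos_right B.m hK)
  have hsq : B.numItems ^ 2 ≤ B.m ^ (2 * B.K) := mul_sq_le_pow_two_mul hK hKm
  calc min B.n (2 * B.m) * B.searchTime
      = (B.m + 1) ^ (4 * B.K) *
          ((B.numItems + 1) * (min B.n (2 * B.m) * (B.numItems + B.n + 1))) := by ring
    _ ≤ (B.m + 1) ^ (4 * B.K) * (2 * B.numItems * (4 * (B.numItems * B.n))) :=
      Nat.mul_le_mul_left _ (Nat.mul_le_mul (by lia) hstrips)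
    _ = 8 * ((B.m + 1) ^ (4 * B.K) * (B.numItems ^ 2 * B.n)) := by ring
    _ ≤ 8 * ((B.m + 1) ^ (4 * B.K) * (B.m ^ (2 * B.K) * B.n)) :=
      Nat.mul_le_mul_left _ (Nat.mul_le_mul_left _ (Nat.mul_le_mul_right _ hsq))

theorem CoverTask.cast_min_mul_searchTime_le {B : CoverTask} (hm : 0 < B.m) (hK : 0 < B.K)
    (hKm : B.K ≤ B.m) :
    ((min B.n (2 * B.m) * B.searchTime : ℕ) : ℝ) ≤
      8 * Real.exp 4 * ((B.m : ℝ) ^ (6 * B.K) * B.n) :=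
  calc ((min B.n (2 * B.m) * B.searchTime : ℕ) : ℝ)
      ≤ 8 * (((B.m : ℝ) + 1) ^ (4 * B.K) * ((B.m : ℝ) ^ (2 * B.K) * B.n)) := by
        exact_mod_cast B.min_mul_searchTime_le hm hK hKm
    _ ≤ 8 * (Real.exp 4 * (B.m : ℝ) ^ (4 * B.K) * ((B.m : ℝ) ^ (2 * B.K) * B.n)) := by
      gcongr
      exact add_one_pow_le_exp_mul_pow hm hKm
    _ = 8 * Real.exp 4 * ((B.m : ℝ) ^ (6 * B.K) * B.n) := by
      rw [show 6 * B.K = 4 * B.K + 2 * B.K by ring, pow_add]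
      ring

end RunningTime

theorem ApproximatesWithin.mono {A : Program} {ρ k : ℕ} {T T' : ℕ → ℕ → ℝ}
    (h : ApproximatesWithin A ρ k T) (hT : ∀ n m, T n m ≤ T' n m) :
    ApproximatesWithin A ρ k T' := by
  intro n m P D hn hP
  obtain ⟨t, s, hexec, ht, hcover⟩ := h n m P D hn hP
  exact ⟨t, s, hexec, ht.trans (hT n m), hcover⟩

theorem ApproximatesWithin.mul_log {A : Program} {ρ k : ℕ} {C : ℝ} {f : ℕ → ℕ → ℝ}
    (h : ApproximatesWithin A ρ k fun n m => C * f n m) (hf : ∀ n m, 0 ≤ f n m) (hk : 1 ≤ k) :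
    ApproximatesWithin A ρ k fun n m => |C| / Real.log 2 * (f n m * Real.log ((k : ℝ) + 1)) := by
  refine h.mono fun n m => ?_
  calc C * f n m ≤ |C| * f n m := mul_le_mul_of_nonneg_right (le_abs_self C) (hf n m)
    _ = |C| / Real.log 2 * (f n m * Real.log 2) := by field_simp
    _ ≤ |C| / Real.log 2 * (f n m * Real.log ((k : ℝ) + 1)) := by
      gcongr
      · exact hf n m
      · exact_mod_cast Nat.succ_le_succ hk

theorem CoverProgram.main_approximatesWithin (k : ℕ) :
    ApproximatesWithin main 4 k fun n m => 24000 * Real.exp 4 * ((m : ℝ) ^ (6 * k) * n) := by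
  intro n m P D hn hP
  obtain ⟨G, hG⟩ := hP.exists_solution
  have hM : 0 < m * min k m := hG.numItems_pos hn
  have hm : 0 < m := Nat.pos_of_mul_pos_right hM
  obtain ⟨t, s, hexec, ht, Z, hZ, hout, hbelow⟩ := main_runs (instanceTask_inputOf P D k) hn hG
  refine ⟨t, s, hexec, ?_, isColoredCover_of_outputOf hZ hout hbelow⟩
  have htime := (instanceTask P D k).cast_min_mul_searchTime_le hm (Nat.pos_of_mul_pos_left hM)
    (min_le_right _ _)
  calc (t : ℝ) ≤ 3000 * (min n (2 * m) * (instanceTask P D k).searchTime : ℕ) := by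
        exact_mod_cast ht
    _ ≤ 3000 * (8 * Real.exp 4 * ((m : ℝ) ^ (6 * min k m) * n)) := by gcongr; exact htime
    _ = 24000 * Real.exp 4 * ((m : ℝ) ^ (6 * min k m) * n) := by ring
    _ ≤ 24000 * Real.exp 4 * ((m : ℝ) ^ (6 * k) * n) := by
      gcongr
      · exact_mod_cast hm
      · exact min_le_left _ _

theorem mainTheorem2_general :
    ∃ (A : Program) (C : ℝ), ∀ k : ℕ,
      ApproximatesWithin A 4 k fun n m => C * ((m : ℝ) ^ (6 * k) * n) :=
  ⟨main, 24000 * Real.exp 4, main_approximatesWithin⟩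

theorem mainTheorem2 :
    (∃ (A : RealRAM.Program) (C : ℝ), ∀ k : ℕ, 1 ≤ k →
      ApproximatesWithin A 4 k
        (fun n m => C * ((m : ℝ) ^ (6 * k) * (n : ℝ) * Real.log ((k : ℝ) + 1)))) ∧
    (∃ (A : RealRAM.Program) (C : ℝ),
      ApproximatesWithin A 4 3 (fun n m => C * ((m : ℝ) ^ 18 * (n : ℝ)))) := by
  obtain ⟨A, C, h⟩ := mainTheorem2_general
  exact ⟨⟨A, |C| / Real.log 2, fun k hk => (h k).mul_log (fun n m => by positivity) hk⟩,
    A, C, h 3⟩
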